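/- Let $M=2^{16}$. There is an absolute constant $D_2>0$ such that the following holds for every $3/2<\alpha<2$. Setting. Let $\Lambda$ be a square domain with free or periodic boundary conditions: the graph on the vertex set $\{0,\dots,L-1\}^2$, $L>1$ ($L$ even in the periodic case), in which two vertices are adjacent if they agree in one coordinate and differ by exactly one (periodic case: exactly one modulo $L$) in the other. Let $\operatorname{dist}$ be the graph distance of $\Lambda$. For each $j\in\Lambda$ let $\lambda_j(\phi)=1+2\sum_{q=1}^{N_j}\hat\lambda_j(q)\cos(q\phi)$ with an integer $N_j>0$ and real $\hat\lambda_j(q)$, and put $\hat\lambda_j(q)=0$ for $q>N_j$. A density is a function $\varrho:\Lambda\to\mathbb Z$, not identically zero; it is neutral if $\sum_j\varrho(j)=0$. Write $\operatorname{supp}\varrho=\{j:\varrho(j)\ne0\}$, $d(\varrho)=\max_{i,j\in\operatorname{supp}\varrho}\operatorname{dist}(i,j)$, $\operatorname{dist}(\varrho_1,\varrho_2)=\min_{i\in\operatorname{supp}\varrho_1,\,j\in\operatorname{supp}\varrho_2}\operatorname{dist}(i,j)$, and $\langle\psi,\varrho\rangle=\sum_j\psi(j)\varrho(j)$. An ensemble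 is a finite, possibly empty, set of densities with mutually disjoint supports. A $2^k\times2^k$ square ($k\ge0$) is a product of two intervals (periodic case: cyclic intervals) of $2^k$ consecutive elements of $\{0,\dots,L-1\}$ if $2^k\le L$, and is all of $\Lambda$ if $2^k>L$. Let $|\mathscr S_k(\varrho)|$ be the minimal number of $2^k\times 2^k$ squares needed to cover $\operatorname{supp}\varrho$. Put $A(\varrho)=\sum_{k=0}^{n(\varrho)}|\mathscr S_k(\varrho)|$ with $n(\varrho)=\lceil\log_2(M\,d(\varrho)^\alpha)\rceil$ if $d(\varrho)\ge1$, and $A(\varrho)=0$ if $d(\varrho)=0$. Claim. There exist a finite collection $\mathscr F$ of ensembles, positive numbers $c_{\mathscr N}$, $\mathscr N\in\mathscr F$, summing to $1$, and real numbers $K(\varrho)$, $\varrho\in\mathscr N\in\mathscr F$, such that for every $\psi:\Lambda\to\mathbb R$ $$\prod_{j\in\Lambda}\lambda_j(\psi(j))=\sum_{\mathscr N\in\mathscr F}c_{\mathscr N}\prod_{\varrho\in\mathscr N}\bigl[1+K(\varrho)\cos\langle\psi,\varrho\rangle\bigr],$$ and such that each $\mathscr N\in\mathscr F$ satisfies: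 (a) $\mathscr N$ contains at most one non-neutral density. (b) Distinct $\varrho_1,\varrho_2\in\mathscr N$ satisfy $\operatorname{dist}(\varrho_1,\varrho_2)\ge M[\min(d(\varrho_1),d(\varrho_2))]^\alpha$. Moreover, if $\varrho_c\in\mathscr N$ is non-neutral, then $\operatorname{dist}(\varrho,\varrho_c)\ge M[d(\varrho)]^\alpha$ for all $\varrho\in\mathscr N$, $\varrho\neq\varrho_c$. (c) If $\varrho\in\mathscr N$ is neutral and $\varrho=\varrho_1+\varrho_2$ with densities $\varrho_1,\varrho_2$ of disjoint supports satisfying $\operatorname{dist}(\varrho_1,\varrho_2)\ge 2M[\min(d(\varrho_1),d(\varrho_2))]^\alpha$, then $\varrho_1$ and $\varrho_2$ are non-neutral. (d) For every neutral $\varrho\in\mathscr N$, $$|K(\varrho)|\le e^{D_2A(\varrho)}\prod_{j\in\operatorname{supp}\varrho}e^{\varrho(j)^2}\bigl|\hat\lambda_j(|\varrho(j)|)\bigr|.$$ -/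

import Mathlib

namespace BKT

/-- The two kinds of boundary conditions under consideration. -/
inductive BC
  | free
  | per

/-- The vertex set `{0, …, L-1}²`. -/
abbrev Site (L : ℕ) : Type := Fin L × Fin L

/-- The side lengths that are allowed: `L > 1`, and moreover `L` even for periodic b.c. -/
def BC.Admissible : BC → ℕ → Prop
  | .free, L => 1 < L
  | .per, L => 1 < L ∧ Even L

/-- The square domain of side length `L`. `SimpleGraph.fromRel` symmetrizes the relation, so two
vertices are adjacent iff they agree in one coordinate and differ by exactly one (periodic b.c.:
by exactly one modulo `L`) in the other. -/
def domain : BC → (L : ℕ) → SimpleGraph (Site L)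
  | .free, _ => SimpleGraph.fromRel fun p q =>
      (p.1 = q.1 ∧ (p.2 : ℕ) + 1 = q.2) ∨ (p.2 = q.2 ∧ (p.1 : ℕ) + 1 = q.1)
  | .per, L => SimpleGraph.fromRel fun p q =>
      (p.1 = q.1 ∧ (p.2 : ℕ) + 1 ≡ q.2 [MOD L]) ∨ (p.2 = q.2 ∧ (p.1 : ℕ) + 1 ≡ q.1 [MOD L])

/-- `lam` is a real, even, normalized trigonometric polynomial with coefficients `lamHat q`,
`q ≥ 1`, extended by `0` beyond the degree. The value `lamHat 0` plays no role. -/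
def IsTrigPoly (lam : ℝ → ℝ) (lamHat : ℕ → ℝ) : Prop :=
  ∃ N : ℕ, 0 < N ∧ (∀ q, N < q → lamHat q = 0) ∧
    ∀ φ : ℝ, lam φ = 1 + 2 * ∑ q ∈ Finset.Icc 1 N, lamHat q * Real.cos (q * φ)

/-- The support of a density. -/
def supp {L : ℕ} (ρ : Site L → ℤ) : Finset (Site L) :=
  Finset.univ.filter fun j => ρ j ≠ 0

/-- The charge of a density. -/
def charge {L : ℕ} (ρ : Site L → ℤ) : ℤ := ∑ j, ρ j

/-- A density is neutral if its charge vanishes. -/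
def Neutral {L : ℕ} (ρ : Site L → ℤ) : Prop := charge ρ = 0

/-- An ensemble: a finite, possibly empty, collection of densities (integer-valued functions that
are not identically zero) whose supports are mutually disjoint. -/
def IsEnsemble {L : ℕ} (E : Finset (Site L → ℤ)) : Prop :=
  (∀ ρ ∈ E, ρ ≠ 0) ∧ ∀ ρ₁ ∈ E, ∀ ρ₂ ∈ E, ρ₁ ≠ ρ₂ → Disjoint (supp ρ₁) (supp ρ₂)

/-- The pairing `⟨ψ, ρ⟩`. -/
def pairing {L : ℕ} (ψ : Site L → ℝ) (ρ : Site L → ℤ) : ℝ := ∑ j, ψ j * (ρ j : ℝ)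

/-- The diameter `d(ρ)` of a density, in the graph distance. -/
noncomputable def diam (bc : BC) {L : ℕ} (ρ : Site L → ℤ) : ℕ :=
  (supp ρ).sup fun i => (supp ρ).sup fun j => (domain bc L).dist i j

/-- The distance between the supports of two densities, in the graph distance. -/
noncomputable def distance (bc : BC) {L : ℕ} (ρ₁ ρ₂ : Site L → ℤ) : ℕ :=
  sInf {n | ∃ i ∈ supp ρ₁, ∃ j ∈ supp ρ₂, n = (domain bc L).dist i j}

/-- The constant `M = 2 ^ 16`. -/
def M : ℝ := 2 ^ 16

/-- The coordinate `c` lies in the interval of `n` consecutive coordinates starting at `a`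
(periodic b.c.: cyclically). -/
def InInterval : BC → {L : ℕ} → ℕ → Fin L → Fin L → Prop
  | .free, _, n, a, c => (a : ℕ) ≤ c ∧ (c : ℕ) < a + n
  | .per, L, n, a, c => ((c : ℤ) - (a : ℤ)) % (L : ℤ) < n

/-- `s` is a `2^k × 2^k` square. Squares with `2^k ≤ L` are full, i.e. have `2^k * 2^k` points; for
`2^k > L` the only square is the whole domain. -/
def IsDyadicSquare (bc : BC) {L : ℕ} (k : ℕ) (s : Finset (Site L)) : Prop :=
  (∃ a b : Fin L, ∀ p : Site L,
      p ∈ s ↔ InInterval bc (2 ^ k) a p.1 ∧ InInterval bc (2 ^ k) b p.2) ∧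
    (2 ^ k ≤ L → s.card = 2 ^ k * 2 ^ k) ∧ (L < 2 ^ k → s = Finset.univ)

/-- The minimal number of `2^k × 2^k` squares in a cover of the support of `ρ`. -/
noncomputable def coverNumber (bc : BC) {L : ℕ} (k : ℕ) (ρ : Site L → ℤ) : ℕ :=
  sInf {n | ∃ C : Finset (Finset (Site L)),
    (∀ s ∈ C, IsDyadicSquare bc k s) ∧ supp ρ ⊆ C.biUnion id ∧ C.card = n}

/-- `n(ρ) = ⌈log₂ (M d(ρ)^α)⌉`, used only for `d(ρ) ≥ 1`, where the logarithm is positive. -/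
noncomputable def scale (bc : BC) (α : ℝ) {L : ℕ} (ρ : Site L → ℤ) : ℕ :=
  ⌈Real.logb 2 (M * (diam bc ρ : ℝ) ^ α)⌉₊

/-- `A(ρ)`: the sum of the cover numbers over the scales `0, …, n(ρ)` if `d(ρ) ≥ 1`, and `0` if
`d(ρ) = 0`. -/
noncomputable def coverSum (bc : BC) (α : ℝ) {L : ℕ} (ρ : Site L → ℤ) : ℕ :=
  if diam bc ρ = 0 then 0
  else ∑ k ∈ Finset.range (scale bc α ρ + 1), coverNumber bc k ρ

end BKT

/-! Say that two densities interact at distance r if each of them is charged or satisfies r < M d^α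
(`Reaches`). If no two densities of an ensemble interact at any distance between their points, then
(a) and (b) hold. The product is therefore rewritten, by successive convex combinations, until no
interaction is left.

Since 2 ∑ e^{-q²} ≤ 1, each λ_j is a convex combination of 1 and of the factors 1 + e^{q²} λ̂_j(q)
cos(qφ), so the product over sites is a mixture of products over single-site charges. Two
interacting factors are replaced by one through `listProd_merge`: (1 + a cos x)(1 + b cos y) =
(1/3)(1 + 3a cos x) + (1/3)(1 + 3b cos y) + (1/6)(1 + 3ab cos(x+y)) + (1/6)(1 + 3ab cos(x-y)). Pairs
are treated in order of increasing distance m. Hence every density is connected by steps of length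
at most m, and from this and the interaction of the merged pair it follows that no neutral part of a
density ever lies beyond its own range from the rest (`NeutralIrreducible.add`); this gives (c).

For (d) the factors 3 are counted scale by scale, 2^k ≤ m < 2^(k+1). A density surviving an
encounter marks a site of its vanished partner. The marks of one density are 2^k-separated and
within 2^(k+1) of its support, so there are at most 100 of them per square of a cover
(`card_le_coverNumber`). When two densities merge, their counts from finer scales add up, which
superadditivity of the cover numbers absorbs (`coverNumber_add_le`). A neutral density takes part in
scale k only if 2^k < M d^α, that is only for k ≤ n(ρ), whence at most 100 A(ρ) factors 3. Finally
all exponents are raised to this maximum, so that K depends on ρ alone. -/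

namespace BKT

/-! ### Graph distance in terms of coordinate offsets, for both boundary conditions -/

/-- Equality of integer coordinates, modulo `L` for periodic boundary conditions. -/
def CoordEq : BC → ℕ → ℤ → ℤ → Prop
  | .free, _, x, y => x = y
  | .per, L, x, y => x ≡ y [ZMOD L]

lemma CoordEq.refl (bc : BC) (L : ℕ) (x : ℤ) : CoordEq bc L x x := by
  cases bc
  · exact rfl
  · exact Int.ModEq.refl x

lemma CoordEq.symm {bc : BC} {L : ℕ} {x y : ℤ} (h : CoordEq bc L x y) : CoordEq bc L y x := by
  cases bc
  · exact Eq.symm h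
  · exact Int.ModEq.symm h

lemma CoordEq.trans {bc : BC} {L : ℕ} {x y z : ℤ} (h : CoordEq bc L x y)
    (h' : CoordEq bc L y z) : CoordEq bc L x z := by
  cases bc
  · exact Eq.trans h h'
  · exact Int.ModEq.trans h h'

lemma CoordEq.add_right {bc : BC} {L : ℕ} {x y : ℤ} (h : CoordEq bc L x y) (z : ℤ) :
    CoordEq bc L (x + z) (y + z) := by
  cases bc
  · exact congrArg (· + z) h
  · exact Int.ModEq.add_right z h

lemma BC.Admissible.one_lt {bc : BC} {L : ℕ} (h : bc.Admissible L) : 1 < L := by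
  cases bc
  · exact h
  · exact h.1

lemma not_natModEq_succ_self {L x : ℕ} (hL : 1 < L) : ¬ (x + 1 ≡ x [MOD L]) := by
  intro h
  have h1 : 1 ≡ 0 [MOD L] := Nat.ModEq.add_left_cancel' x (by simpa using h)
  have := (Nat.modEq_zero_iff_dvd).1 h1
  have := Nat.le_of_dvd one_pos this
  omega

lemma adj_iff_coordEq {bc : BC} {L : ℕ} (hL : 1 < L) (p q : Site L) :
    (domain bc L).Adj p q ↔
      ((p.1 = q.1 ∧ (CoordEq bc L q.2 (p.2 + 1) ∨ CoordEq bc L p.2 (q.2 + 1))) ∨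
        (p.2 = q.2 ∧ (CoordEq bc L q.1 (p.1 + 1) ∨ CoordEq bc L p.1 (q.1 + 1)))) := by
  obtain ⟨⟨a, ha⟩, ⟨b, hb⟩⟩ := p
  obtain ⟨⟨c, hc⟩, ⟨d, hd⟩⟩ := q
  cases bc
  · simp only [domain, SimpleGraph.fromRel_adj, CoordEq, ne_eq, Prod.mk.injEq, Fin.mk.injEq]
    omega
  · have key : ∀ x y : ℕ, ((x : ℤ) ≡ (y : ℤ) + 1 [ZMOD L]) ↔ (y + 1 ≡ x [MOD L]) := by
      intro x y
      rw [Int.modEq_comm, ← Int.natCast_modEq_iff]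
      push_cast
      rfl
    simp only [domain, SimpleGraph.fromRel_adj, CoordEq, ne_eq, Prod.mk.injEq, Fin.mk.injEq, key]
    constructor
    · rintro ⟨_, h | h⟩ <;> grind
    · intro h
      refine ⟨?_, by grind⟩
      rintro ⟨rfl, rfl⟩
      have h1 := not_natModEq_succ_self (x := a) hL
      have h2 := not_natModEq_succ_self (x := b) hL
      tauto

lemma exists_coordEq_succ {bc : BC} {L : ℕ} (a b : Fin L) (u : ℕ)
    (h : CoordEq bc L b (a + ((u + 1 : ℕ) : ℤ))) : ∃ x : Fin L, CoordEq bc L x (a + 1) := by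
  cases bc
  · refine ⟨⟨a + 1, ?_⟩, ?_⟩
    · simp only [CoordEq] at h
      omega
    · simp [CoordEq]
  · have hL : 0 < L := a.pos
    refine ⟨⟨(a + 1) % L, Nat.mod_lt _ hL⟩, ?_⟩
    simp only [CoordEq]
    push_cast
    exact Int.mod_modEq _ _

lemma exists_walk_snd {bc : BC} {L : ℕ} (hL : 1 < L) (u : ℕ) :
    ∀ (c a b : Fin L), CoordEq bc L b (a + (u : ℤ)) →
      ∃ w : (domain bc L).Walk (c, a) (c, b), w.length ≤ u := by
  induction u with
  | zero =>
    intro c a b h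
    have : b = a := by
      cases bc
      · simp only [CoordEq] at h
        omega
      · simp only [CoordEq, Int.ModEq, Nat.cast_zero, add_zero] at h
        rw [Int.emod_eq_of_lt (by omega) (by omega), Int.emod_eq_of_lt (by omega) (by omega)] at h
        omega
    subst this
    exact ⟨.nil, by simp⟩
  | succ u ih =>
    intro c a b h
    obtain ⟨x, hx⟩ := exists_coordEq_succ a b u h
    have hb : CoordEq bc L b (x + (u : ℤ)) := by
      refine h.trans ?_
      have := (hx.add_right (u : ℤ)).symm
      push_cast
      rwa [show (a : ℤ) + (u + 1) = a + 1 + u by ring]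
    obtain ⟨w, hw⟩ := ih c x b hb
    have hadj : (domain bc L).Adj (c, a) (c, x) :=
      (adj_iff_coordEq hL _ _).2 (Or.inl ⟨rfl, Or.inl hx⟩)
    exact ⟨.cons hadj w, by simpa using hw⟩

lemma exists_walk_fst {bc : BC} {L : ℕ} (hL : 1 < L) (u : ℕ) :
    ∀ (c a b : Fin L), CoordEq bc L b (a + (u : ℤ)) →
      ∃ w : (domain bc L).Walk (a, c) (b, c), w.length ≤ u := by
  intro c a b h
  obtain ⟨w, hw⟩ := exists_walk_snd hL u c a b h
  let f : (domain bc L) →g (domain bc L) :=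
    ⟨Prod.swap, fun {p q} hpq => by
      rw [adj_iff_coordEq hL] at hpq ⊢
      exact hpq.symm⟩
  exact ⟨w.map f, by simpa using hw⟩

lemma CoordEq.sub {bc : BC} {L : ℕ} {x y z : ℤ} (h : CoordEq bc L x (y + z)) :
    CoordEq bc L y (x + -z) := by
  have := (h.add_right (-z)).symm
  simpa using this

lemma exists_walk_of_coordEq {bc : BC} {L : ℕ} (hL : 1 < L) {p q : Site L} {u v : ℤ}
    (hu : CoordEq bc L q.1 (p.1 + u)) (hv : CoordEq bc L q.2 (p.2 + v)) :
    ∃ w : (domain bc L).Walk p q, w.length ≤ u.natAbs + v.natAbs := by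
  obtain ⟨a, b⟩ := p
  obtain ⟨c, d⟩ := q
  have h1 : ∃ w : (domain bc L).Walk (a, b) (c, b), w.length ≤ u.natAbs := by
    rcases Int.natAbs_eq u with h | h
    · exact exists_walk_fst hL _ b a c (h ▸ hu)
    · obtain ⟨w, hw⟩ := exists_walk_fst hL u.natAbs b c a (by
        have := hu.sub
        rwa [show -u = (u.natAbs : ℤ) by omega] at this)
      exact ⟨w.reverse, by simpa using hw⟩
  have h2 : ∃ w : (domain bc L).Walk (c, b) (c, d), w.length ≤ v.natAbs := by
    rcases Int.natAbs_eq v with h | h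
    · exact exists_walk_snd hL _ c b d (h ▸ hv)
    · obtain ⟨w, hw⟩ := exists_walk_snd hL v.natAbs c d b (by
        have := hv.sub
        rwa [show -v = (v.natAbs : ℤ) by omega] at this)
      exact ⟨w.reverse, by simpa using hw⟩
  obtain ⟨w1, h1⟩ := h1
  obtain ⟨w2, h2⟩ := h2
  exact ⟨w1.append w2, by simpa using Nat.add_le_add h1 h2⟩

lemma dist_le_of_coordEq {bc : BC} {L : ℕ} (hL : 1 < L) {p q : Site L} {u v : ℤ}
    (hu : CoordEq bc L q.1 (p.1 + u)) (hv : CoordEq bc L q.2 (p.2 + v)) :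
    (domain bc L).dist p q ≤ u.natAbs + v.natAbs := by
  obtain ⟨w, hw⟩ := exists_walk_of_coordEq hL hu hv
  exact (SimpleGraph.dist_le w).trans hw

lemma domain_connected (bc : BC) {L : ℕ} (hL : 1 < L) : (domain bc L).Connected := by
  have : Nonempty (Site L) := ⟨(⟨0, by omega⟩, ⟨0, by omega⟩)⟩
  refine ⟨fun p q => ?_⟩
  obtain ⟨w, -⟩ := exists_walk_of_coordEq (bc := bc) hL (p := p) (q := q)
    (u := q.1 - p.1) (v := q.2 - p.2)
    (by simpa using CoordEq.refl bc L _) (by simpa using CoordEq.refl bc L _)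
  exact ⟨w⟩

lemma dist_pos_of_ne (bc : BC) {L : ℕ} (hL : 1 < L) {p q : Site L} (h : p ≠ q) :
    0 < (domain bc L).dist p q :=
  (domain_connected bc hL).pos_dist_of_ne h

lemma dist_lt_two_mul (bc : BC) {L : ℕ} (hL : 1 < L) (p q : Site L) :
    (domain bc L).dist p q < 2 * L := by
  have := dist_le_of_coordEq (bc := bc) hL (p := p) (q := q)
    (u := q.1 - p.1) (v := q.2 - p.2)
    (by simpa using CoordEq.refl bc L _) (by simpa using CoordEq.refl bc L _)
  omega

lemma exists_coordEq_of_walk {bc : BC} {L : ℕ} (hL : 1 < L) {p q : Site L}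
    (w : (domain bc L).Walk p q) : ∃ u v : ℤ, u.natAbs ≤ w.length ∧ v.natAbs ≤ w.length ∧
      CoordEq bc L q.1 (p.1 + u) ∧ CoordEq bc L q.2 (p.2 + v) := by
  induction w with
  | nil => exact ⟨0, 0, by simp, by simp, by simpa using CoordEq.refl bc L _,
      by simpa using CoordEq.refl bc L _⟩
  | @cons a b c hab w ih =>
    obtain ⟨u, v, hu, hv, h1, h2⟩ := ih
    have hstep : ∃ x y : ℤ, x.natAbs ≤ 1 ∧ y.natAbs ≤ 1 ∧
        CoordEq bc L b.1 (a.1 + x) ∧ CoordEq bc L b.2 (a.2 + y) := by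
      rcases (adj_iff_coordEq hL _ _).1 hab with ⟨he, h | h⟩ | ⟨he, h | h⟩
      · exact ⟨0, 1, by simp, by simp, by simpa [he] using CoordEq.refl bc L _, h⟩
      · exact ⟨0, -1, by simp, by simp, by simpa [he] using CoordEq.refl bc L _, h.sub⟩
      · exact ⟨1, 0, by simp, by simp, h, by simpa [he] using CoordEq.refl bc L _⟩
      · exact ⟨-1, 0, by simp, by simp, h.sub, by simpa [he] using CoordEq.refl bc L _⟩
    obtain ⟨x, y, hx, hy, h3, h4⟩ := hstep
    refine ⟨x + u, y + v, ?_, ?_, ?_, ?_⟩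
    · simp only [SimpleGraph.Walk.length_cons]
      omega
    · simp only [SimpleGraph.Walk.length_cons]
      omega
    · rw [← add_assoc]
      exact h1.trans (h3.add_right u)
    · rw [← add_assoc]
      exact h2.trans (h4.add_right v)

/-- Each step of a walk changes one coordinate by one. Together with `dist_le_of_coordEq` this
compares the graph distance with offsets from both sides; no exact formula for the distance is
needed. -/
lemma exists_coordEq_of_dist (bc : BC) {L : ℕ} (hL : 1 < L) (p q : Site L) :
    ∃ u v : ℤ, u.natAbs ≤ (domain bc L).dist p q ∧ v.natAbs ≤ (domain bc L).dist p q ∧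
      CoordEq bc L q.1 (p.1 + u) ∧ CoordEq bc L q.2 (p.2 + v) := by
  obtain ⟨w, hw⟩ := (domain_connected bc hL).exists_walk_length_eq_dist p q
  rw [← hw]
  exact exists_coordEq_of_walk hL w

/-! ### Dyadic squares and cover numbers -/

lemma InInterval.exists_coordEq {bc : BC} {L n : ℕ} {a c : Fin L} (h : InInterval bc n a c) :
    ∃ u : ℤ, 0 ≤ u ∧ u < n ∧ CoordEq bc L c (a + u) := by
  have hL : 0 < L := a.pos
  cases bc
  · simp only [InInterval] at h
    exact ⟨c - a, by omega, by omega, by simp [CoordEq]⟩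
  · refine ⟨((c : ℤ) - a) % L, Int.emod_nonneg _ (by omega), h, ?_⟩
    have : (a : ℤ) + ((c : ℤ) - a) % L ≡ a + (c - a) [ZMOD L] :=
      Int.ModEq.add_left _ (Int.mod_modEq _ _)
    simpa [CoordEq] using this.symm

/-- The points of a dyadic square are given by offsets from a corner. -/
lemma IsDyadicSquare.exists_corner {bc : BC} {L k : ℕ} {s : Finset (Site L)}
    (hs : IsDyadicSquare bc k s) : ∃ a b : ℤ, ∀ p ∈ s, ∃ u v : ℤ,
      (0 ≤ u ∧ u < 2 ^ k ∧ CoordEq bc L p.1 (a + u)) ∧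
      (0 ≤ v ∧ v < 2 ^ k ∧ CoordEq bc L p.2 (b + v)) := by
  obtain ⟨⟨a, b, h⟩, -⟩ := hs
  refine ⟨a, b, fun p hp => ?_⟩
  obtain ⟨h1, h2⟩ := (h p).1 hp
  obtain ⟨u, hu⟩ := h1.exists_coordEq
  obtain ⟨v, hv⟩ := h2.exists_coordEq
  exact ⟨u, v, by exact_mod_cast hu, by exact_mod_cast hv⟩

lemma dist_le_of_corner {bc : BC} {L : ℕ} (hL : 1 < L) {p q : Site L} {a b u v u' v' : ℤ}
    (h1 : CoordEq bc L p.1 (a + u)) (h2 : CoordEq bc L p.2 (b + v))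
    (h1' : CoordEq bc L q.1 (a + u')) (h2' : CoordEq bc L q.2 (b + v')) :
    (domain bc L).dist p q ≤ (u' - u).natAbs + (v' - v).natAbs := by
  refine dist_le_of_coordEq hL ?_ ?_
  · have := h1.symm.add_right (u' - u)
    rw [show a + u + (u' - u) = a + u' by ring] at this
    exact h1'.trans this
  · have := h2.symm.add_right (v' - v)
    rw [show b + v + (v' - v) = b + v' by ring] at this
    exact h2'.trans this

lemma IsDyadicSquare.dist_lt {bc : BC} {L k : ℕ} (hL : 1 < L) {s : Finset (Site L)}
    (hs : IsDyadicSquare bc k s) {p q : Site L} (hp : p ∈ s) (hq : q ∈ s) :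
    (domain bc L).dist p q < 2 ^ (k + 1) := by
  obtain ⟨a, b, h⟩ := hs.exists_corner
  obtain ⟨u, v, ⟨hu0, hu1, hu⟩, hv0, hv1, hv⟩ := h p hp
  obtain ⟨u', v', ⟨hu0', hu1', hu'⟩, hv0', hv1', hv'⟩ := h q hq
  have := dist_le_of_corner hL hu hv hu' hv'
  have h2 : ((2 ^ k : ℕ) : ℤ) = 2 ^ k := by push_cast; rfl
  rw [pow_succ]
  omega

open Classical in
lemma exists_inInterval_card (bc : BC) {L n : ℕ} (hn0 : 0 < n) (hn : n ≤ L) (x : Fin L) :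
    ∃ a : Fin L, InInterval bc n a x ∧
      (Finset.univ.filter fun c => InInterval bc n a c).card = n := by
  have hL : 0 < L := x.pos
  cases bc
  -- The interval is pushed back from the right boundary so that it keeps all its n points.
  · refine ⟨⟨min x (L - n), by omega⟩, ?_, ?_⟩
    · simp only [InInterval]
      omega
    · have : ((Finset.univ.filter fun c : Fin L =>
          InInterval .free n ⟨min x (L - n), by omega⟩ c).map Fin.valEmbedding) =
          Finset.Ico (min (x : ℕ) (L - n)) (min (x : ℕ) (L - n) + n) := by
        ext c
        rw [Finset.mem_map, Finset.mem_Ico]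
        constructor
        · rintro ⟨c, h, rfl⟩
          exact (Finset.mem_filter.1 h).2
        · intro h
          exact ⟨⟨c, by omega⟩, Finset.mem_filter.2 ⟨Finset.mem_univ _, h⟩, rfl⟩
      rw [← Finset.card_map Fin.valEmbedding, this]
      simp
  · refine ⟨x, ?_, ?_⟩
    · simp only [InInterval, sub_self, Int.zero_emod]
      omega
    · symm
      rw [← Finset.card_range n]
      refine Finset.card_bij (fun u _ => ⟨(x + u) % L, Nat.mod_lt _ hL⟩) ?_ ?_ ?_
      · intro u hu
        have hu := Finset.mem_range.1 hu
        simp only [Finset.mem_filter, Finset.mem_univ, true_and, InInterval, Int.natCast_mod,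
          Nat.cast_add, Int.emod_sub_emod, add_sub_cancel_left, Finset.card_range]
        rw [Int.emod_eq_of_lt (by omega) (by omega)]
        omega
      · intro u hu v hv h
        have hu := Finset.mem_range.1 hu
        have hv := Finset.mem_range.1 hv
        simp only [Fin.mk.injEq] at h
        have h' : u ≡ v [MOD L] := Nat.ModEq.add_left_cancel' (x : ℕ) h
        exact Nat.ModEq.eq_of_lt_of_lt h' (by omega) (by omega)
      · intro c hc
        simp only [Finset.mem_filter, Finset.mem_univ, true_and, InInterval,
          Finset.card_range] at hc
        have h0 := Int.emod_nonneg ((c : ℤ) - x) (b := L) (by omega)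
        refine ⟨(((c : ℤ) - x) % L).toNat, Finset.mem_range.2 (by omega), ?_⟩
        ext
        have : ((((x : ℕ) + (((c : ℤ) - x) % L).toNat) % L : ℕ) : ℤ) = c := by
          push_cast
          rw [Int.toNat_of_nonneg h0, Int.add_emod_emod, add_sub_cancel,
            Int.emod_eq_of_lt (by omega) (by omega)]
        exact_mod_cast this

lemma exists_dyadicSquare (bc : BC) {L : ℕ} (k : ℕ) (p : Site L) :
    ∃ s : Finset (Site L), IsDyadicSquare bc k s ∧ p ∈ s := by
  classical
  have hL : 0 < L := p.1.pos
  by_cases hk : 2 ^ k ≤ L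
  · obtain ⟨a, ha, hca⟩ := exists_inInterval_card bc (by positivity) hk p.1
    obtain ⟨b, hb, hcb⟩ := exists_inInterval_card bc (by positivity) hk p.2
    refine ⟨(Finset.univ.filter fun c => InInterval bc (2 ^ k) a c) ×ˢ
      (Finset.univ.filter fun c => InInterval bc (2 ^ k) b c), ⟨⟨a, b, ?_⟩, ?_, ?_⟩, ?_⟩
    · intro q
      simp
    · intro _
      rw [Finset.card_product, hca, hcb]
    · intro h
      omega
    · simp [ha, hb]
  · have hall : ∀ c : Fin L, InInterval bc (2 ^ k) ⟨0, hL⟩ c := by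
      intro c
      cases bc
      · simp only [InInterval]
        omega
      · simp only [InInterval]
        have h2 : ((2 ^ k : ℕ) : ℤ) = 2 ^ k := by push_cast; rfl
        rw [Int.emod_eq_of_lt (by omega) (by simp)]
        simp only [CharP.cast_eq_zero, sub_zero]
        omega
    exact ⟨Finset.univ, ⟨⟨⟨0, hL⟩, ⟨0, hL⟩, fun q => by simp [hall]⟩, fun h => absurd h hk,
      fun _ => rfl⟩, Finset.mem_univ _⟩

/-- The minimum in the definition of the cover number is attained. -/
lemma exists_cover (bc : BC) {L : ℕ} (k : ℕ) (ρ : Site L → ℤ) :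
    ∃ C : Finset (Finset (Site L)), (∀ s ∈ C, IsDyadicSquare bc k s) ∧
      supp ρ ⊆ C.biUnion id ∧ C.card = coverNumber bc k ρ := by
  classical
  refine Nat.sInf_mem (s := {n | ∃ C : Finset (Finset (Site L)),
    (∀ s ∈ C, IsDyadicSquare bc k s) ∧ supp ρ ⊆ C.biUnion id ∧ C.card = n}) ?_
  choose f hf hpf using exists_dyadicSquare bc (L := L) k
  refine ⟨_, (supp ρ).image f, ?_, ?_, rfl⟩
  · intro s hs
    obtain ⟨p, -, rfl⟩ := Finset.mem_image.1 hs
    exact hf p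
  · intro p hp
    exact Finset.mem_biUnion.2 ⟨f p, Finset.mem_image_of_mem f hp, hpf p⟩

lemma coverNumber_le {bc : BC} {L k : ℕ} {ρ : Site L → ℤ} {C : Finset (Finset (Site L))}
    (hC : ∀ s ∈ C, IsDyadicSquare bc k s) (h : supp ρ ⊆ C.biUnion id) :
    coverNumber bc k ρ ≤ C.card :=
  Nat.sInf_le ⟨C, hC, h, rfl⟩

/-- The cover number is superadditive for densities at distance at least `2 ^ (k + 1)`. -/
lemma coverNumber_add_le {bc : BC} {L k : ℕ} (hL : 1 < L) {σ τ ρ : Site L → ℤ}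
    (hσ : supp σ ⊆ supp ρ) (hτ : supp τ ⊆ supp ρ)
    (h : ∀ i ∈ supp σ, ∀ j ∈ supp τ, 2 ^ (k + 1) ≤ (domain bc L).dist i j) :
    coverNumber bc k σ + coverNumber bc k τ ≤ coverNumber bc k ρ := by
  classical
  obtain ⟨C, hC, hcov, hcard⟩ := exists_cover bc k ρ
  have aux : ∀ η : Site L → ℤ, supp η ⊆ supp ρ →
      coverNumber bc k η ≤ (C.filter fun s => (s ∩ supp η).Nonempty).card := by
    intro η hη
    refine coverNumber_le (fun s hs => hC s (Finset.mem_filter.1 hs).1) fun p hp => ?_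
    obtain ⟨s, hs, hps⟩ := Finset.mem_biUnion.1 (hcov (hη hp))
    exact Finset.mem_biUnion.2
      ⟨s, Finset.mem_filter.2 ⟨hs, p, Finset.mem_inter.2 ⟨hps, hp⟩⟩, hps⟩
  refine (Nat.add_le_add (aux σ hσ) (aux τ hτ)).trans ?_
  rw [← Finset.card_union_of_disjoint, ← hcard]
  · exact Finset.card_le_card (Finset.union_subset (Finset.filter_subset _ _)
      (Finset.filter_subset _ _))
  · rw [Finset.disjoint_left]
    intro s hs hs'
    obtain ⟨hsC, i, hi⟩ := Finset.mem_filter.1 hs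
    obtain ⟨-, j, hj⟩ := Finset.mem_filter.1 hs'
    rw [Finset.mem_inter] at hi hj
    have h1 := (hC s hsC).dist_lt hL hi.1 hj.1
    have h2 := h i hi.2 j hj.2
    omega

/-- A `2 ^ k`-separated set near the support of `ρ` has at most `100` points for each square of
a cover. -/
lemma card_le_coverNumber {bc : BC} {L k : ℕ} (hL : 1 < L) {ρ : Site L → ℤ}
    {T : Finset (Site L)} (hsep : ∀ p ∈ T, ∀ q ∈ T, p ≠ q → 2 ^ k ≤ (domain bc L).dist p q)
    (hnear : ∀ t ∈ T, ∃ i ∈ supp ρ, (domain bc L).dist i t < 2 ^ (k + 1)) :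
    T.card ≤ 100 * coverNumber bc k ρ := by
  classical
  obtain ⟨C, hC, hcov, hcard⟩ := exists_cover bc k ρ
  have hcorner : ∀ s : Finset (Site L), ∃ ab : ℤ × ℤ, s ∈ C → ∀ p ∈ s, ∃ u v : ℤ,
      (0 ≤ u ∧ u < 2 ^ k ∧ CoordEq bc L p.1 (ab.1 + u)) ∧
      (0 ≤ v ∧ v < 2 ^ k ∧ CoordEq bc L p.2 (ab.2 + v)) := by
    intro s
    by_cases hs : s ∈ C
    · obtain ⟨a, b, h⟩ := (hC s hs).exists_corner
      exact ⟨(a, b), fun _ => h⟩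
    · exact ⟨0, fun h => absurd h hs⟩
  choose cor hcor using hcorner
  have hpos : (0 : ℤ) < 2 ^ k := by positivity
  -- A point near a square has offsets from its corner in (-2·2^k, 3·2^k). Cells of half side 2^k/2
  -- then number 10 in each direction, hence the 100. Offsets are doubled rather than the cells
  -- halved, so that k = 0 needs no special care.
  have hex : ∀ t : Site L, ∃ x : Finset (Site L) × ℤ × ℤ, t ∈ T → x.1 ∈ C ∧
      CoordEq bc L t.1 ((cor x.1).1 + x.2.1) ∧ CoordEq bc L t.2 ((cor x.1).2 + x.2.2) ∧
      2 * x.2.1 / 2 ^ k ∈ Finset.Ico (-4 : ℤ) 6 ∧ 2 * x.2.2 / 2 ^ k ∈ Finset.Ico (-4 : ℤ) 6 := by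
    intro t
    by_cases ht : t ∈ T
    swap
    · exact ⟨(∅, 0, 0), fun h => absurd h ht⟩
    obtain ⟨i, hi, hit⟩ := hnear t ht
    obtain ⟨s, hs, his⟩ := Finset.mem_biUnion.1 (hcov hi)
    obtain ⟨u, v, ⟨hu0, hu1, hu⟩, hv0, hv1, hv⟩ := hcor s hs i his
    obtain ⟨x, y, hx, hy, hx1, hy1⟩ := exists_coordEq_of_dist bc hL i t
    have h2 : ((2 ^ k : ℕ) : ℤ) = 2 ^ k := by push_cast; rfl
    have key : ∀ a b : ℤ, 0 ≤ a → a < 2 ^ k → b.natAbs < 2 ^ (k + 1) →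
        2 * (a + b) / 2 ^ k ∈ Finset.Ico (-4 : ℤ) 6 := by
      intro a b h0 h1 hb
      rw [pow_succ] at hb
      rw [Finset.mem_Ico]
      exact ⟨(Int.le_ediv_iff_mul_le hpos).2 (by omega),
        (Int.ediv_lt_iff_lt_mul hpos).2 (by omega)⟩
    refine ⟨(s, u + x, v + y), fun _ => ⟨hs, ?_, ?_, ?_, ?_⟩⟩
    · exact hx1.trans (by simpa [add_assoc] using hu.add_right x)
    · exact hy1.trans (by simpa [add_assoc] using hv.add_right y)
    · exact key u x hu0 hu1 (hx.trans_lt hit)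
    · exact key v y hv0 hv1 (hy.trans_lt hit)
  choose f hf using hex
  let g : Site L → Finset (Site L) × ℤ × ℤ :=
    fun t => ((f t).1, 2 * (f t).2.1 / 2 ^ k, 2 * (f t).2.2 / 2 ^ k)
  have hmaps : ∀ t ∈ T, g t ∈ C ×ˢ (Finset.Ico (-4 : ℤ) 6 ×ˢ Finset.Ico (-4 : ℤ) 6) := by
    intro t ht
    obtain ⟨h1, -, -, h2, h3⟩ := hf t ht
    exact Finset.mem_product.2 ⟨h1, Finset.mem_product.2 ⟨h2, h3⟩⟩
  have hinj : Set.InjOn g T := by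
    intro p hp q hq hpq
    by_contra hne
    have hd := hsep p hp q hq hne
    obtain ⟨-, h1, h2, -, -⟩ := hf p hp
    obtain ⟨-, h1', h2', -, -⟩ := hf q hq
    simp only [g, Prod.mk.injEq] at hpq
    obtain ⟨e1, e2, e3⟩ := hpq
    rw [← e1] at h1' h2'
    have hle := dist_le_of_corner hL h1 h2 h1' h2'
    -- Within one cell each offset varies by less than 2^k/2, so two points are closer than 2^k: a
    -- cell holds at most one point of T.
    have key : ∀ a b : ℤ, 2 * a / 2 ^ k = 2 * b / 2 ^ k → 2 * (b - a).natAbs < 2 ^ k := by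
      intro a b hab
      have ha := Int.mul_ediv_add_emod (2 * a) (2 ^ k)
      have hb := Int.mul_ediv_add_emod (2 * b) (2 ^ k)
      have ha0 := Int.emod_nonneg (2 * a) hpos.ne'
      have hb0 := Int.emod_nonneg (2 * b) hpos.ne'
      have ha1 := Int.emod_lt_of_pos (2 * a) hpos
      have hb1 := Int.emod_lt_of_pos (2 * b) hpos
      have h2 : ((2 ^ k : ℕ) : ℤ) = 2 ^ k := by push_cast; rfl
      rw [hab] at ha
      omega
    have k1 := key _ _ e2
    have k2 := key _ _ e3
    omega
  calc T.card ≤ (C ×ˢ (Finset.Ico (-4 : ℤ) 6 ×ˢ Finset.Ico (-4 : ℤ) 6)).card :=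
        Finset.card_le_card_of_injOn g hmaps hinj
    _ = 100 * coverNumber bc k ρ := by
        rw [Finset.card_product, Finset.card_product, hcard]
        simp [mul_comm]

/-! ### Interaction range, irreducibility and merging of densities -/

section Densities

variable {bc : BC} {α : ℝ} {L : ℕ}

lemma mem_supp {ρ : Site L → ℤ} {j : Site L} : j ∈ supp ρ ↔ ρ j ≠ 0 := by
  simp [supp]

lemma supp_neg (ρ : Site L → ℤ) : supp (-ρ) = supp ρ := by
  ext j
  simp [mem_supp]

lemma supp_nonempty {ρ : Site L → ℤ} (h : ρ ≠ 0) : (supp ρ).Nonempty := by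
  by_contra hne
  rw [Finset.not_nonempty_iff_eq_empty] at hne
  apply h
  funext j
  by_contra hj
  have : j ∈ supp ρ := mem_supp.2 hj
  simp [hne] at this

lemma supp_add {σ τ : Site L → ℤ} (h : Disjoint (supp σ) (supp τ)) :
    supp (σ + τ) = supp σ ∪ supp τ := by
  ext j
  have : ¬ (j ∈ supp σ ∧ j ∈ supp τ) := fun hj => Finset.disjoint_left.1 h hj.1 hj.2
  simp only [mem_supp, Finset.mem_union, Pi.add_apply] at this ⊢
  by_cases h1 : σ j = 0
  · simp [h1]
  · have h2 : τ j = 0 := by tauto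
    simp [h2]

lemma supp_add_sdiff_left {σ τ : Site L → ℤ} (h : Disjoint (supp σ) (supp τ)) :
    supp (σ + τ) \ supp σ = supp τ := by
  rw [supp_add h, Finset.union_sdiff_left, Finset.sdiff_eq_self_of_disjoint h.symm]

lemma supp_add_sdiff_right {σ τ : Site L → ℤ} (h : Disjoint (supp σ) (supp τ)) :
    supp (σ + τ) \ supp τ = supp σ := by
  rw [add_comm]
  exact supp_add_sdiff_left h.symm

lemma add_apply_of_mem_left {σ τ : Site L → ℤ} (h : Disjoint (supp σ) (supp τ)) {i : Site L}
    (hi : i ∈ supp σ) : (σ + τ) i = σ i := by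
  have : i ∉ supp τ := fun h' => Finset.disjoint_left.1 h hi h'
  rw [mem_supp, not_not] at this
  simp [this]

lemma neutral_neg (ρ : Site L → ℤ) : Neutral (-ρ) ↔ Neutral ρ := by
  simp [Neutral, charge]

lemma charge_eq_sum_supp (ρ : Site L → ℤ) : charge ρ = ∑ j ∈ supp ρ, ρ j := by
  unfold charge supp
  rw [Finset.sum_filter_ne_zero]

lemma diam_neg (ρ : Site L → ℤ) : diam bc (-ρ) = diam bc ρ := by
  simp only [diam, supp_neg]

lemma coverNumber_neg (k : ℕ) (ρ : Site L → ℤ) : coverNumber bc k (-ρ) = coverNumber bc k ρ := by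
  simp only [coverNumber, supp_neg]

/-- The diameter of a set of sites. -/
noncomputable def setDiam (bc : BC) (S : Finset (Site L)) : ℕ :=
  S.sup fun i => S.sup fun j => (domain bc L).dist i j

lemma dist_le_setDiam {S : Finset (Site L)} {i j : Site L} (hi : i ∈ S) (hj : j ∈ S) :
    (domain bc L).dist i j ≤ setDiam bc S :=
  (Finset.le_sup (f := fun j => (domain bc L).dist i j) hj).trans
    (Finset.le_sup (f := fun i => S.sup fun j => (domain bc L).dist i j) hi)

lemma dist_le_diam {ρ : Site L → ℤ} {i j : Site L} (hi : i ∈ supp ρ) (hj : j ∈ supp ρ) :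
    (domain bc L).dist i j ≤ diam bc ρ :=
  dist_le_setDiam hi hj

lemma M_pos : 0 < M := by
  unfold M
  positivity

/-- A set which spans two parts at distance m has diameter at least m, and is then automatically
within its range at distance m. -/
lemma lt_M_mul_rpow (hα : 1 ≤ α) {m d : ℕ} (hm : 0 < m) (hd : m ≤ d) :
    (m : ℝ) < M * (d : ℝ) ^ α := by
  have h1 : (1 : ℝ) ≤ m := by exact_mod_cast hm
  have h2 : (m : ℝ) ≤ d := by exact_mod_cast hd
  have h3 : (d : ℝ) ≤ (d : ℝ) ^ α := Real.self_le_rpow_of_one_le (h1.trans h2) hα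
  have h4 : (2 : ℝ) ≤ M := by
    unfold M
    norm_num
  nlinarith

/-- The density `ρ` interacts with other densities at distance `r`: it is either charged or
`r < M d(ρ)^α`. -/
def Reaches (bc : BC) (α : ℝ) (ρ : Site L → ℤ) (r : ℕ) : Prop :=
  Neutral ρ → (r : ℝ) < M * (diam bc ρ : ℝ) ^ α

lemma Reaches.mono {ρ : Site L → ℤ} {r s : ℕ} (h : Reaches bc α ρ s) (hrs : r ≤ s) :
    Reaches bc α ρ r := by
  intro hn
  have : (r : ℝ) ≤ s := by exact_mod_cast hrs
  exact this.trans_lt (h hn)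

lemma reaches_neg {ρ : Site L → ℤ} {r : ℕ} : Reaches bc α (-ρ) r ↔ Reaches bc α ρ r := by
  simp only [Reaches, neutral_neg, diam_neg]

/-- The support of `ρ` cannot be split in two parts at distance more than `m`. -/
def ChainConnected (bc : BC) (m : ℕ) (ρ : Site L → ℤ) : Prop :=
  ∀ S ⊆ supp ρ, S.Nonempty → (supp ρ \ S).Nonempty →
    ∃ i ∈ S, ∃ j ∈ supp ρ \ S, (domain bc L).dist i j ≤ m

/-- No neutral part `S` of `ρ` is at distance at least `M d(S)^α` from the rest of `ρ`. -/
def NeutralIrreducible (bc : BC) (α : ℝ) (ρ : Site L → ℤ) : Prop :=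
  ∀ S ⊆ supp ρ, S.Nonempty → (supp ρ \ S).Nonempty → ∑ i ∈ S, ρ i = 0 →
    ∃ i ∈ S, ∃ j ∈ supp ρ \ S,
      ((domain bc L).dist i j : ℝ) < M * (setDiam bc S : ℝ) ^ α

lemma ChainConnected.mono {m m' : ℕ} {ρ : Site L → ℤ} (h : ChainConnected bc m ρ)
    (hm : m ≤ m') : ChainConnected bc m' ρ := by
  intro S hS h1 h2
  obtain ⟨i, hi, j, hj, hd⟩ := h S hS h1 h2
  exact ⟨i, hi, j, hj, hd.trans hm⟩

lemma ChainConnected.neg {m : ℕ} {ρ : Site L → ℤ} (h : ChainConnected bc m ρ) :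
    ChainConnected bc m (-ρ) := by
  simpa only [ChainConnected, supp_neg] using h

lemma NeutralIrreducible.neg {ρ : Site L → ℤ} (h : NeutralIrreducible bc α ρ) : NeutralIrreducible bc α (-ρ) := by
  simpa only [NeutralIrreducible, supp_neg, Pi.neg_apply, Finset.sum_neg_distrib, neg_eq_zero] using h

/-- A part of a union of two sets which does not split either of them is one of them. -/
lemma eq_or_eq_of_not_split {A B S : Finset (Site L)}
    (hS : S ⊆ A ∪ B) (hne : S.Nonempty) (hne' : ((A ∪ B) \ S).Nonempty)
    (hA : ¬ ((S ∩ A).Nonempty ∧ (A \ (S ∩ A)).Nonempty))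
    (hB : ¬ ((S ∩ B).Nonempty ∧ (B \ (S ∩ B)).Nonempty)) : S = A ∨ S = B := by
  have hA' : S ∩ A = ∅ ∨ A ⊆ S := by
    by_cases h : (S ∩ A).Nonempty
    · right
      intro x hx
      by_contra hxS
      exact hA ⟨h, x, by simp [hx, hxS]⟩
    · left
      exact Finset.not_nonempty_iff_eq_empty.1 h
  have hB' : S ∩ B = ∅ ∨ B ⊆ S := by
    by_cases h : (S ∩ B).Nonempty
    · right
      intro x hx
      by_contra hxS
      exact hB ⟨h, x, by simp [hx, hxS]⟩
    · left
      exact Finset.not_nonempty_iff_eq_empty.1 h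
  have hdec : S = (S ∩ A) ∪ (S ∩ B) := by
    rw [← Finset.inter_union_distrib_left, Finset.inter_eq_left.2 hS]
  rcases hA' with hA' | hA' <;> rcases hB' with hB' | hB'
  · rw [hA', hB'] at hdec
    simp [hdec] at hne
  · right
    rw [hdec, hA', Finset.empty_union]
    exact Finset.inter_eq_right.2 hB'
  · left
    rw [hdec, hB', Finset.union_empty]
    exact Finset.inter_eq_right.2 hA'
  · rw [Finset.sdiff_eq_empty_iff_subset.2 (Finset.union_subset hA' hB')] at hne'
    simp at hne'

/-- Two densities at distance `m`, both interacting at that distance. -/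
structure Linked (bc : BC) (α : ℝ) (m : ℕ) (σ τ : Site L → ℤ) : Prop where
  disjoint : Disjoint (supp σ) (supp τ)
  le_dist : ∀ i ∈ supp σ, ∀ j ∈ supp τ, m ≤ (domain bc L).dist i j
  exists_dist : ∃ i ∈ supp σ, ∃ j ∈ supp τ, (domain bc L).dist i j = m
  left : Reaches bc α σ m
  right : Reaches bc α τ m

lemma Linked.symm {m : ℕ} {σ τ : Site L → ℤ} (h : Linked bc α m σ τ) : Linked bc α m τ σ where
  disjoint := h.disjoint.symm
  le_dist i hi j hj := by
    rw [SimpleGraph.dist_comm]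
    exact h.le_dist j hj i hi
  exists_dist := by
    obtain ⟨i, hi, j, hj, hd⟩ := h.exists_dist
    exact ⟨j, hj, i, hi, by rwa [SimpleGraph.dist_comm]⟩
  left := h.right
  right := h.left

lemma Linked.neg_right {m : ℕ} {σ τ : Site L → ℤ} (h : Linked bc α m σ τ) :
    Linked bc α m σ (-τ) where
  disjoint := by simpa only [supp_neg] using h.disjoint
  le_dist := by simpa only [supp_neg] using h.le_dist
  exists_dist := by simpa only [supp_neg] using h.exists_dist
  left := h.left
  right := reaches_neg.2 h.right

lemma Linked.le_diam_add {m : ℕ} {σ τ : Site L → ℤ} (h : Linked bc α m σ τ) :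
    m ≤ diam bc (σ + τ) := by
  obtain ⟨i, hi, j, hj, rfl⟩ := h.exists_dist
  apply dist_le_diam <;> rw [supp_add h.disjoint] <;> simp [hi, hj]

lemma Linked.reaches_add {m : ℕ} {σ τ : Site L → ℤ} (h : Linked bc α m σ τ) (hα : 1 ≤ α)
    (hm : 0 < m) : Reaches bc α (σ + τ) m :=
  fun _ => lt_M_mul_rpow hα hm h.le_diam_add

lemma ChainConnected.exists_of_split {m : ℕ} {σ ρ : Site L → ℤ} {S : Finset (Site L)}
    (h : ChainConnected bc m σ) (hσ : supp σ ⊆ supp ρ) (h1 : (S ∩ supp σ).Nonempty)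
    (h2 : (supp σ \ (S ∩ supp σ)).Nonempty) :
    ∃ i ∈ S, ∃ j ∈ supp ρ \ S, (domain bc L).dist i j ≤ m := by
  obtain ⟨i, hi, j, hj, hd⟩ := h _ Finset.inter_subset_right h1 h2
  simp only [Finset.mem_inter, Finset.mem_sdiff] at hi hj
  exact ⟨i, hi.1, j, Finset.mem_sdiff.2 ⟨hσ hj.1, fun h => hj.2 ⟨h, hj.1⟩⟩, hd⟩

/-- A partition of the union either cuts one of the two supports, which is crossed by a short step
already, or separates exactly one from the other, and then the linking pair crosses it. -/
lemma ChainConnected.add {m : ℕ} {σ τ : Site L → ℤ} (h : Linked bc α m σ τ)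
    (hσ : ChainConnected bc m σ) (hτ : ChainConnected bc m τ) :
    ChainConnected bc m (σ + τ) := by
  intro S hS h1 h2
  have hs := supp_add h.disjoint
  by_cases hA : (S ∩ supp σ).Nonempty ∧ (supp σ \ (S ∩ supp σ)).Nonempty
  · exact hσ.exists_of_split (by simp [hs]) hA.1 hA.2
  by_cases hB : (S ∩ supp τ).Nonempty ∧ (supp τ \ (S ∩ supp τ)).Nonempty
  · exact hτ.exists_of_split (by simp [hs]) hB.1 hB.2
  rcases eq_or_eq_of_not_split (hs ▸ hS) h1 (hs ▸ h2) hA hB with rfl | rfl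
  · obtain ⟨i, hi, j, hj, hd⟩ := h.exists_dist
    exact ⟨i, hi, j, (supp_add_sdiff_left h.disjoint).symm ▸ hj, hd.le⟩
  · obtain ⟨i, hi, j, hj, hd⟩ := h.symm.exists_dist
    exact ⟨i, hi, j, (supp_add_sdiff_right h.disjoint).symm ▸ hj, hd.le⟩

/-- A neutral part of `σ + τ` which splits `σ` is close to the rest. -/
lemma Linked.exists_of_split {m : ℕ} {σ τ : Site L → ℤ} (h : Linked bc α m σ τ) (hα : 1 ≤ α)
    (hm : 0 < m) (hσ : ChainConnected bc m σ) (hσ' : NeutralIrreducible bc α σ)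
    {S : Finset (Site L)} (hS : S ⊆ supp (σ + τ)) (h0 : ∑ i ∈ S, (σ + τ) i = 0)
    (hA : (S ∩ supp σ).Nonempty ∧ (supp σ \ (S ∩ supp σ)).Nonempty) :
    ∃ i ∈ S, ∃ j ∈ supp (σ + τ) \ S,
      ((domain bc L).dist i j : ℝ) < M * (setDiam bc S : ℝ) ^ α := by
  have hs := supp_add h.disjoint
  by_cases hτ : (S ∩ supp τ).Nonempty
  · obtain ⟨i, hi, j, hj, hd⟩ := hσ.exists_of_split (ρ := σ + τ) (by simp [hs]) hA.1 hA.2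
    refine ⟨i, hi, j, hj, ?_⟩
    obtain ⟨p, hp⟩ := hA.1
    obtain ⟨q, hq⟩ := hτ
    rw [Finset.mem_inter] at hp hq
    have hmd : m ≤ setDiam bc S :=
      (h.le_dist p hp.2 q hq.2).trans (dist_le_setDiam hp.1 hq.1)
    exact lt_of_le_of_lt (by exact_mod_cast hd) (lt_M_mul_rpow hα hm hmd)
  · rw [Finset.not_nonempty_iff_eq_empty] at hτ
    have hSσ : S ⊆ supp σ := by
      intro x hx
      have := hS hx
      rw [hs, Finset.mem_union] at this
      refine this.resolve_right fun hxτ => ?_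
      have : x ∈ S ∩ supp τ := Finset.mem_inter.2 ⟨hx, hxτ⟩
      simp [hτ] at this
    rw [Finset.inter_eq_left.2 hSσ] at hA
    have h0' : ∑ i ∈ S, σ i = 0 := by
      rw [← h0]
      exact Finset.sum_congr rfl fun i hi => (add_apply_of_mem_left h.disjoint (hSσ hi)).symm
    obtain ⟨i, hi, j, hj, hd⟩ := hσ' S hSσ hA.1 hA.2 h0'
    refine ⟨i, hi, j, ?_, hd⟩
    rw [Finset.mem_sdiff] at hj ⊢
    exact ⟨by simp [hs, hj.1], hj.2⟩

lemma Linked.exists_of_left {m : ℕ} {σ τ : Site L → ℤ} (h : Linked bc α m σ τ)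
    (h0 : ∑ i ∈ supp σ, (σ + τ) i = 0) :
    ∃ i ∈ supp σ, ∃ j ∈ supp (σ + τ) \ supp σ,
      ((domain bc L).dist i j : ℝ) < M * (setDiam bc (supp σ) : ℝ) ^ α := by
  have hn : Neutral σ := by
    rw [Neutral, charge_eq_sum_supp, ← h0]
    exact Finset.sum_congr rfl fun i hi => (add_apply_of_mem_left h.disjoint hi).symm
  obtain ⟨i, hi, j, hj, hd⟩ := h.exists_dist
  refine ⟨i, hi, j, (supp_add_sdiff_left h.disjoint).symm ▸ hj, ?_⟩
  rw [hd]
  exact h.left hn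

/-- Let S be a neutral part. If it cuts one support and meets the other, its diameter is at least m
while a step of length at most m leaves it. If it lies properly inside one support, irreducibility
of that density applies. If it is one of the two supports, that density is neutral and reaches m
because the pair is linked. -/
lemma NeutralIrreducible.add {m : ℕ} {σ τ : Site L → ℤ} (h : Linked bc α m σ τ) (hα : 1 ≤ α)
    (hm : 0 < m) (hσ : ChainConnected bc m σ) (hτ : ChainConnected bc m τ)
    (hσ' : NeutralIrreducible bc α σ) (hτ' : NeutralIrreducible bc α τ) : NeutralIrreducible bc α (σ + τ) := by
  intro S hS h1 h2 h0
  have hs := supp_add h.disjoint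
  by_cases hA : (S ∩ supp σ).Nonempty ∧ (supp σ \ (S ∩ supp σ)).Nonempty
  · exact h.exists_of_split hα hm hσ hσ' hS h0 hA
  by_cases hB : (S ∩ supp τ).Nonempty ∧ (supp τ \ (S ∩ supp τ)).Nonempty
  · rw [add_comm σ τ] at *
    exact h.symm.exists_of_split hα hm hτ hτ' hS h0 hB
  rcases eq_or_eq_of_not_split (hs ▸ hS) h1 (hs ▸ h2) hA hB with rfl | rfl
  · exact h.exists_of_left h0
  · rw [add_comm σ τ] at *
    exact h.symm.exists_of_left h0

/-! ### Cover numbers summed over scales -/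

/-- The sum of the cover numbers over the scales below `k`. -/
noncomputable def coverBelow (bc : BC) (k : ℕ) (ρ : Site L → ℤ) : ℕ :=
  ∑ j ∈ Finset.range k, coverNumber bc j ρ

lemma coverBelow_mono (ρ : Site L → ℤ) {k k' : ℕ} (h : k ≤ k') :
    coverBelow bc k ρ ≤ coverBelow bc k' ρ :=
  Finset.sum_le_sum_of_subset (Finset.range_mono h)

lemma coverBelow_neg (k : ℕ) (ρ : Site L → ℤ) : coverBelow bc k (-ρ) = coverBelow bc k ρ := by
  simp only [coverBelow, coverNumber_neg]

lemma Linked.coverBelow_add_le {m k : ℕ} {σ τ : Site L → ℤ} (h : Linked bc α m σ τ)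
    (hL : 1 < L) (hk : 2 ^ k ≤ m) :
    coverBelow bc k σ + coverBelow bc k τ ≤ coverBelow bc k (σ + τ) := by
  unfold coverBelow
  rw [← Finset.sum_add_distrib]
  refine Finset.sum_le_sum fun l hl => ?_
  have hs := supp_add h.disjoint
  refine coverNumber_add_le hL (by simp [hs]) (by simp [hs]) fun i hi j hj => ?_
  refine (le_trans ?_ hk).trans (h.le_dist i hi j hj)
  exact Nat.pow_le_pow_right two_pos (Finset.mem_range.1 hl)

open Classical in
/-- The bound, up to a factor `100`, for the number of factors `3` gathered by a density: `A(ρ)`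
if `ρ` is neutral, and a sum over all relevant scales if it is not. -/
noncomputable def maxExponent (bc : BC) (α : ℝ) (ρ : Site L → ℤ) : ℕ :=
  if Neutral ρ then coverSum bc α ρ else coverBelow bc (2 * L) ρ

/-- For neutral ρ, 2^k < M d^α forces k ≤ n(ρ), so the scales 0, …, k are all counted in A(ρ). -/
lemma coverBelow_le_maxExponent {k : ℕ} {ρ : Site L → ℤ} (hα : 1 ≤ α) (hk : k < 2 * L)
    (h : Reaches bc α ρ (2 ^ k)) : coverBelow bc (k + 1) ρ ≤ maxExponent bc α ρ := by
  unfold maxExponent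
  split_ifs with hn
  · have hlt := h hn
    push_cast at hlt
    -- At diameter 0 the range is 0^α = 0, so the default value of `coverSum` does not occur here.
    have hd : diam bc ρ ≠ 0 := by
      intro h0
      rw [h0, Nat.cast_zero, Real.zero_rpow (by linarith), mul_zero] at hlt
      exact absurd hlt (by simp)
    rw [coverSum, if_neg hd]
    refine coverBelow_mono ρ (Nat.succ_le_succ ?_)
    unfold scale
    have hpos : (0 : ℝ) < M * (diam bc ρ : ℝ) ^ α := lt_trans (by positivity) hlt
    have h1 : (k : ℝ) ≤ Real.logb 2 (M * (diam bc ρ : ℝ) ^ α) := by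
      rw [Real.le_logb_iff_rpow_le one_lt_two hpos]
      simpa using hlt.le
    exact_mod_cast h1.trans (Nat.le_ceil _)
  · exact coverBelow_mono ρ hk

lemma maxExponent_neg (ρ : Site L → ℤ) : maxExponent bc α (-ρ) = maxExponent bc α ρ := by
  by_cases h : Neutral ρ
  all_goals simp [maxExponent, neutral_neg, h, coverSum, scale, diam_neg, coverNumber_neg, coverBelow_neg]

end Densities

/-! ### Items and the invariants of the merging procedure -/

/-- A density together with the number of factors `3` it has gathered, and a set of sites
accounting for those gathered on the current scale. -/
structure Item (L : ℕ) where
  /-- the density -/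
  dens : Site L → ℤ
  /-- the number of factors `3` -/
  exp : ℕ
  /-- the sites accounting for the factors of the current scale -/
  marks : Finset (Site L)

section Items

variable {bc : BC} {α : ℝ} {L : ℕ}

/-- The invariant of a single item while distances `m`, `2 ^ k ≤ m ≤ 2 ^ (k + 1)`, are treated. -/
structure ItemInv (bc : BC) (α : ℝ) (k m : ℕ) (x : Item L) : Prop where
  ne_zero : x.dens ≠ 0
  chain : ChainConnected bc m x.dens
  irred : NeutralIrreducible bc α x.dens
  inactive : ¬ Reaches bc α x.dens (2 ^ k) →
    x.exp ≤ 100 * coverBelow bc k x.dens ∧ x.exp ≤ 100 * maxExponent bc α x.dens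
  active : Reaches bc α x.dens (2 ^ k) → x.exp + 1 ≤ 100 * coverBelow bc k x.dens + x.marks.card
  sep : ∀ p ∈ x.marks, ∀ q ∈ x.marks, p ≠ q → 2 ^ k ≤ (domain bc L).dist p q
  near : ∀ t ∈ x.marks, ∃ i ∈ supp x.dens, (domain bc L).dist i t < 2 ^ (k + 1)

/-- Two densities interacting at their distance have distance at least `m`. -/
def FarApart (bc : BC) (α : ℝ) (m : ℕ) (σ τ : Site L → ℤ) : Prop :=
  ∀ i ∈ supp σ, ∀ j ∈ supp τ, Reaches bc α σ ((domain bc L).dist i j) →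
    Reaches bc α τ ((domain bc L).dist i j) → m ≤ (domain bc L).dist i j

/-- The invariant of a pair of items. -/
structure PairInv (bc : BC) (α : ℝ) (k m : ℕ) (x y : Item L) : Prop where
  disjoint : Disjoint (supp x.dens) (supp y.dens)
  far : FarApart bc α m x.dens y.dens
  sep : Reaches bc α x.dens (2 ^ k) → Reaches bc α y.dens (2 ^ k) →
    ∀ p ∈ supp x.dens ∪ x.marks, ∀ q ∈ supp y.dens ∪ y.marks, 2 ^ k ≤ (domain bc L).dist p q

lemma FarApart.symm {m : ℕ} {σ τ : Site L → ℤ} (h : FarApart bc α m σ τ) :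
    FarApart bc α m τ σ := by
  intro i hi j hj h1 h2
  rw [SimpleGraph.dist_comm] at *
  exact h j hj i hi h2 h1

lemma PairInv.symm {k m : ℕ} {x y : Item L} (h : PairInv bc α k m x y) :
    PairInv bc α k m y x where
  disjoint := h.disjoint.symm
  far := h.far.symm
  sep h1 h2 p hp q hq := by
    rw [SimpleGraph.dist_comm]
    exact h.sep h2 h1 q hq p hp

/-- The item with the opposite density. -/
def Item.neg (x : Item L) : Item L := ⟨-x.dens, x.exp, x.marks⟩

/-- The item which results when `y` is merged into `x`. -/
def Item.add (x y : Item L) : Item L :=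
  ⟨x.dens + y.dens, x.exp + y.exp + 1, x.marks ∪ y.marks⟩

/-- The item which results when `x` survives the encounter with an item containing the site `t`. -/
def Item.survive (x : Item L) (t : Site L) : Item L := ⟨x.dens, x.exp + 1, insert t x.marks⟩

lemma ItemInv.neg {k m : ℕ} {x : Item L} (h : ItemInv bc α k m x) :
    ItemInv bc α k m x.neg where
  ne_zero := neg_ne_zero.2 h.ne_zero
  chain := h.chain.neg
  irred := h.irred.neg
  inactive := by
    simpa only [Item.neg, reaches_neg, coverBelow_neg, maxExponent_neg] using h.inactive
  active := by simpa only [Item.neg, reaches_neg, coverBelow_neg] using h.active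
  sep := h.sep
  near := by simpa only [Item.neg, supp_neg] using h.near

lemma PairInv.neg_right {k m : ℕ} {x y : Item L} (h : PairInv bc α k m x y) :
    PairInv bc α k m x y.neg where
  disjoint := by simpa only [Item.neg, supp_neg] using h.disjoint
  far := by simpa only [Item.neg, FarApart, reaches_neg, supp_neg] using h.far
  sep := by simpa only [Item.neg, reaches_neg, supp_neg] using h.sep

lemma PairInv.neg_left {k m : ℕ} {x y : Item L} (h : PairInv bc α k m x y) :
    PairInv bc α k m x.neg y :=
  h.symm.neg_right.symm

lemma ItemInv.mono {k m m' : ℕ} {x : Item L} (h : ItemInv bc α k m x) (hm : m ≤ m') :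
    ItemInv bc α k m' x :=
  { h with chain := h.chain.mono hm }

section Merge

variable {k m : ℕ} {x y w : Item L}

/-- The count closes because of the spare unit in `active`: (e₁ + e₂ + 1) + 1 = (e₁ + 1) + (e₂ + 1).
The two mark sets are disjoint since distinct active items keep their marks 2^k apart, and cover
numbers below scale k are superadditive at distance m ≥ 2^k. -/
lemma ItemInv.add (hx : ItemInv bc α k m x) (hy : ItemInv bc α k m y)
    (hxy : PairInv bc α k m x y) (h : Linked bc α m x.dens y.dens) (hL : 1 < L) (hα : 1 ≤ α)
    (hk : 2 ^ k ≤ m) : ItemInv bc α k m (x.add y) := by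
  classical
  have hm : 0 < m := lt_of_lt_of_le (by positivity) hk
  have hsupp : supp (x.add y).dens = supp x.dens ∪ supp y.dens := supp_add h.disjoint
  have hxk := h.left.mono hk
  have hyk := h.right.mono hk
  have hsep := hxy.sep hxk hyk
  have hdisj : Disjoint x.marks y.marks := by
    rw [Finset.disjoint_left]
    intro p hp hq
    have := hsep p (Finset.mem_union_right _ hp) p (Finset.mem_union_right _ hq)
    rw [SimpleGraph.dist_self] at this
    exact absurd this (by simp)
  refine ⟨?_, hx.chain.add h hy.chain, hx.irred.add h hα hm hx.chain hy.chain hy.irred,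
    fun hn => absurd ((h.reaches_add hα hm).mono hk) hn, fun _ => ?_, ?_, ?_⟩
  · intro h0
    obtain ⟨i, hi⟩ := supp_nonempty hx.ne_zero
    have : i ∈ supp (x.add y).dens := by simp [hsupp, hi]
    rw [mem_supp, h0] at this
    simp at this
  · have h1 := hx.active hxk
    have h2 := hy.active hyk
    have h3 := h.coverBelow_add_le hL hk
    simp only [Item.add, Finset.card_union_of_disjoint hdisj]
    omega
  · intro p hp q hq hpq
    simp only [Item.add, Finset.mem_union] at hp hq
    rcases hp with hp | hp <;> rcases hq with hq | hq
    · exact hx.sep p hp q hq hpq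
    · exact hsep p (Finset.mem_union_right _ hp) q (Finset.mem_union_right _ hq)
    · rw [SimpleGraph.dist_comm]
      exact hsep q (Finset.mem_union_right _ hq) p (Finset.mem_union_right _ hp)
    · exact hy.sep p hp q hq hpq
  · intro t ht
    simp only [Item.add, Finset.mem_union] at ht
    rw [hsupp]
    rcases ht with ht | ht
    · obtain ⟨i, hi, hd⟩ := hx.near t ht
      exact ⟨i, Finset.mem_union_left _ hi, hd⟩
    · obtain ⟨i, hi, hd⟩ := hy.near t ht
      exact ⟨i, Finset.mem_union_right _ hi, hd⟩

/-- The merged density may interact farther than its parts, but not below m in a new way: both parts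
reach m already, so a violation at distance less than m would be one for x or for y. -/
lemma PairInv.add (hx : PairInv bc α k m x w) (hy : PairInv bc α k m y w)
    (h : Linked bc α m x.dens y.dens) (hk : 2 ^ k ≤ m) : PairInv bc α k m (x.add y) w := by
  classical
  have hsupp : supp (x.add y).dens = supp x.dens ∪ supp y.dens := supp_add h.disjoint
  refine ⟨?_, ?_, ?_⟩
  · rw [hsupp, Finset.disjoint_union_left]
    exact ⟨hx.disjoint, hy.disjoint⟩
  · intro i hi j hj _ h2
    by_contra hlt
    rw [hsupp, Finset.mem_union] at hi
    rcases hi with hi | hi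
    · exact hlt (hx.far i hi j hj (h.left.mono (by omega)) h2)
    · exact hlt (hy.far i hi j hj (h.right.mono (by omega)) h2)
  · intro _ hw p hp q hq
    have hx' := hx.sep (h.left.mono hk) hw p
    have hy' := hy.sep (h.right.mono hk) hw p
    rw [hsupp] at hp
    simp only [Item.add, Finset.mem_union] at hp hx' hy'
    rcases hp with (hp | hp) | (hp | hp)
    · exact hx' (Or.inl hp) q (Finset.mem_union.1 hq)
    · exact hy' (Or.inl hp) q (Finset.mem_union.1 hq)
    · exact hx' (Or.inr hp) q (Finset.mem_union.1 hq)
    · exact hy' (Or.inr hp) q (Finset.mem_union.1 hq)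

/-- The additional factor 3 is paid for by the new mark t, taken from the partner that disappears.
It is new and separated from the old marks because x and y were both active. -/
lemma ItemInv.survive (hx : ItemInv bc α k m x) (hxy : PairInv bc α k m x y)
    (h : Linked bc α m x.dens y.dens) (hk : 2 ^ k ≤ m) (hm : m < 2 ^ (k + 1)) {i t : Site L}
    (hi : i ∈ supp x.dens) (ht : t ∈ supp y.dens) (hd : (domain bc L).dist i t = m) :
    ItemInv bc α k m (x.survive t) := by
  classical
  have hxk := h.left.mono hk
  have hsep : ∀ p ∈ x.marks, 2 ^ k ≤ (domain bc L).dist p t := fun p hp =>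
    hxy.sep hxk (h.right.mono hk) p (Finset.mem_union_right _ hp) t (Finset.mem_union_left _ ht)
  have hnot : t ∉ x.marks := by
    intro htx
    have := hsep t htx
    rw [SimpleGraph.dist_self] at this
    exact absurd this (by simp)
  refine ⟨hx.ne_zero, hx.chain, hx.irred, fun hn => absurd hxk hn, fun _ => ?_, ?_, ?_⟩
  · have := hx.active hxk
    simp only [Item.survive, Finset.card_insert_of_notMem hnot]
    omega
  · intro p hp q hq hpq
    simp only [Item.survive, Finset.mem_insert] at hp hq
    rcases hp with rfl | hp <;> rcases hq with rfl | hq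
    · exact absurd rfl hpq
    · rw [SimpleGraph.dist_comm]
      exact hsep q hq
    · exact hsep p hp
    · exact hx.sep p hp q hq hpq
  · intro p hp
    simp only [Item.survive, Finset.mem_insert] at hp
    rcases hp with rfl | hp
    · exact ⟨i, hi, by omega⟩
    · exact hx.near p hp

/-- The mark t inherits its separation from w through the pair (y, w), as a site of the vanished y.
-/
lemma PairInv.survive (hx : PairInv bc α k m x w) (hy : PairInv bc α k m y w)
    (h : Linked bc α m x.dens y.dens) (hk : 2 ^ k ≤ m) {t : Site L} (ht : t ∈ supp y.dens) :
    PairInv bc α k m (x.survive t) w := by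
  classical
  refine ⟨hx.disjoint, hx.far, fun h1 h2 p hp q hq => ?_⟩
  simp only [Item.survive, Finset.mem_union, Finset.mem_insert] at hp
  rcases hp with hp | rfl | hp
  · exact hx.sep h1 h2 p (Finset.mem_union_left _ hp) q hq
  · exact hy.sep (h.right.mono hk) h2 p (Finset.mem_union_left _ ht) q hq
  · exact hx.sep h1 h2 p (Finset.mem_union_right _ hp) q hq

end Merge

/-! ### Lists of items and the passage between scales -/

lemma exists_perm_of_not_pairwise {β : Type*} {P : β → β → Prop} (l : List β)
    (h : ¬ l.Pairwise P) : ∃ x y l', l.Perm (x :: y :: l') ∧ ¬ P x y := by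
  induction l with
  | nil => exact absurd List.Pairwise.nil h
  | cons a l ih =>
    rw [List.pairwise_cons, not_and_or] at h
    rcases h with h | h
    · push Not at h
      obtain ⟨b, hb, hab⟩ := h
      obtain ⟨s, t, rfl⟩ := List.append_of_mem hb
      exact ⟨a, b, s ++ t, List.perm_middle.cons a, hab⟩
    · obtain ⟨x, y, l', hp, hxy⟩ := ih h
      refine ⟨x, y, a :: l', (hp.cons a).trans ?_, hxy⟩
      exact (List.Perm.swap x a _).trans ((List.Perm.swap y a _).cons x)

/-- The invariant of a list of items on scale `k` at distance `m`. -/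
structure ListInv (bc : BC) (α : ℝ) (k m : ℕ) (l : List (Item L)) : Prop where
  item : ∀ x ∈ l, ItemInv bc α k m x
  pair : l.Pairwise (PairInv bc α k m)

lemma ListInv.perm {k m : ℕ} {l l' : List (Item L)} (h : ListInv bc α k m l) (hp : l.Perm l') :
    ListInv bc α k m l' where
  item x hx := h.item x (hp.mem_iff.2 hx)
  pair := (hp.pairwise_iff fun h => PairInv.symm h).1 h.pair

/-- Either all interacting pairs are at distance at least `m + 1`, or some pair is linked at
distance `m`. -/
lemma ListInv.succ_or_linked {k m : ℕ} {l : List (Item L)} (h : ListInv bc α k m l) :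
    ListInv bc α k (m + 1) l ∨
      ∃ x y l', l.Perm (x :: y :: l') ∧ Linked bc α m x.dens y.dens := by
  by_cases hf : l.Pairwise fun x y : Item L => FarApart bc α (m + 1) x.dens y.dens
  · left
    refine ⟨fun x hx => (h.item x hx).mono m.le_succ, ?_⟩
    exact h.pair.imp₂ (fun x y h1 h2 => ⟨h1.disjoint, h2, h1.sep⟩) hf
  · right
    obtain ⟨x, y, l', hp, hxy⟩ := exists_perm_of_not_pairwise l hf
    refine ⟨x, y, l', hp, ?_⟩
    have hpair : PairInv bc α k m x y :=
      (List.pairwise_cons.1 (h.perm hp).pair).1 y List.mem_cons_self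
    unfold FarApart at hxy
    push Not at hxy
    obtain ⟨i, hi, j, hj, h1, h2, hlt⟩ := hxy
    have hge := hpair.far i hi j hj h1 h2
    have heq : (domain bc L).dist i j = m := by omega
    rw [heq] at h1 h2
    refine ⟨hpair.disjoint, fun p hp q hq => ?_, ⟨i, hi, j, hj, heq⟩, h1, h2⟩
    by_contra hpq
    exact hpq (hpair.far p hp q hq (h1.mono (by omega)) (h2.mono (by omega)))

lemma ListInv.cons {k m : ℕ} {x : Item L} {l : List (Item L)} (hx : ItemInv bc α k m x)
    (hp : ∀ w ∈ l, PairInv bc α k m x w) (h : ListInv bc α k m l) :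
    ListInv bc α k m (x :: l) where
  item := List.forall_mem_cons.2 ⟨hx, h.item⟩
  pair := List.pairwise_cons.2 ⟨hp, h.pair⟩

lemma ListInv.tail {k m : ℕ} {x : Item L} {l : List (Item L)}
    (h : ListInv bc α k m (x :: l)) : ListInv bc α k m l where
  item w hw := h.item w (List.mem_cons_of_mem _ hw)
  pair := (List.pairwise_cons.1 h.pair).2

/-- The invariant on a new scale, without its statements about marks. -/
structure ScaleInv (bc : BC) (α : ℝ) (k : ℕ) (l : List (Item L)) : Prop where
  ne_zero : ∀ x ∈ l, x.dens ≠ 0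
  chain : ∀ x ∈ l, ChainConnected bc (2 ^ k) x.dens
  irred : ∀ x ∈ l, NeutralIrreducible bc α x.dens
  exp_le : ∀ x ∈ l, x.exp ≤ 100 * coverBelow bc k x.dens
  exp_le_max : ∀ x ∈ l, x.exp ≤ 100 * maxExponent bc α x.dens
  pair : l.Pairwise fun x y : Item L =>
    Disjoint (supp x.dens) (supp y.dens) ∧ FarApart bc α (2 ^ k) x.dens y.dens

/-- At the end of a scale. -/
lemma ListInv.scaleInv {k : ℕ} {l : List (Item L)} (h : ListInv bc α k (2 ^ (k + 1)) l)
    (hL : 1 < L) (hα : 1 ≤ α) (hk : k < 2 * L) : ScaleInv bc α (k + 1) l := by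
  have hact : ∀ x ∈ l, Reaches bc α x.dens (2 ^ k) →
      x.exp ≤ 100 * coverBelow bc (k + 1) x.dens := by
    intro x hx hr
    -- The marks of scale k are exchanged for 100 times the cover number of that scale.
    have h1 := (h.item x hx).active hr
    have h2 := card_le_coverNumber hL (h.item x hx).sep (h.item x hx).near
    have h3 : coverBelow bc (k + 1) x.dens =
      coverBelow bc k x.dens + coverNumber bc k x.dens := Finset.sum_range_succ _ _
    omega
  refine ⟨fun x hx => (h.item x hx).ne_zero, fun x hx => (h.item x hx).chain,
    fun x hx => (h.item x hx).irred, fun x hx => ?_, fun x hx => ?_,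
    h.pair.imp fun hxy => ⟨hxy.disjoint, hxy.far⟩⟩
  · by_cases hr : Reaches bc α x.dens (2 ^ k)
    · exact hact x hx hr
    · exact ((h.item x hx).inactive hr).1.trans
        (Nat.mul_le_mul_left _ (coverBelow_mono _ k.le_succ))
  · by_cases hr : Reaches bc α x.dens (2 ^ k)
    · exact (hact x hx hr).trans (Nat.mul_le_mul_left _ (coverBelow_le_maxExponent hα hk hr))
    · exact ((h.item x hx).inactive hr).2

open Classical in
/-- The item with a single mark, in its support. -/
noncomputable def Item.remark (x : Item L) : Item L :=
  ⟨x.dens, x.exp, if h : (supp x.dens).Nonempty then {h.choose} else ∅⟩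

lemma Item.exists_remark (x : Item L) (h : x.dens ≠ 0) :
    ∃ t ∈ supp x.dens, x.remark.marks = {t} := by
  have hne := supp_nonempty h
  exact ⟨hne.choose, hne.choose_spec, by simp [Item.remark, hne]⟩

/-- At the beginning of a scale. -/
lemma ScaleInv.listInv {k : ℕ} {l : List (Item L)} (h : ScaleInv bc α k l) :
    ListInv bc α k (2 ^ k) (l.map Item.remark) := by
  have hmarks : ∀ x ∈ l, x.remark.marks ⊆ supp x.dens := by
    intro x hx
    obtain ⟨t, ht, he⟩ := x.exists_remark (h.ne_zero x hx)
    simpa [he] using ht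
  constructor
  · intro y hy
    obtain ⟨x, hx, rfl⟩ := List.mem_map.1 hy
    obtain ⟨t, ht, he⟩ := x.exists_remark (h.ne_zero x hx)
    refine ⟨h.ne_zero x hx, h.chain x hx, h.irred x hx,
      fun _ => ⟨h.exp_le x hx, h.exp_le_max x hx⟩, fun _ => ?_, ?_, ?_⟩
    · rw [he, Finset.card_singleton]
      exact Nat.succ_le_succ (h.exp_le x hx)
    · intro p hp q hq hpq
      rw [he, Finset.mem_singleton] at hp hq
      exact absurd (hp.trans hq.symm) hpq
    · intro p hp
      rw [he, Finset.mem_singleton] at hp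
      subst hp
      exact ⟨p, ht, by simp⟩
  · rw [List.pairwise_map]
    refine h.pair.imp_of_mem ?_
    intro x y hx hy hxy
    refine ⟨hxy.1, hxy.2, fun h1 h2 p hp q hq => ?_⟩
    have hp' : p ∈ supp x.dens := (Finset.union_subset subset_rfl (hmarks x hx)) hp
    have hq' : q ∈ supp y.dens := (Finset.union_subset subset_rfl (hmarks y hy)) hq
    by_contra hlt
    exact hlt (hxy.2 p hp' q hq' (Reaches.mono h1 (by omega)) (Reaches.mono h2 (by omega)))

end Items

/-! ### The merging identity and its iteration -/

section Mixtures

variable {bc : BC} {α : ℝ} {L : ℕ}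

/-- The product of the coefficients `e^{ρ(j)²} λ̂_j(|ρ(j)|)` over the support of `ρ`. -/
noncomputable def activity (lamHat : Site L → ℕ → ℝ) (ρ : Site L → ℤ) : ℝ :=
  ∏ j ∈ supp ρ, (Real.exp ((ρ j : ℝ) ^ 2) * lamHat j (ρ j).natAbs)

lemma activity_neg (lamHat : Site L → ℕ → ℝ) (ρ : Site L → ℤ) :
    activity lamHat (-ρ) = activity lamHat ρ := by
  simp [activity, supp_neg]

lemma activity_add (lamHat : Site L → ℕ → ℝ) {σ τ : Site L → ℤ}
    (h : Disjoint (supp σ) (supp τ)) :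
    activity lamHat (σ + τ) = activity lamHat σ * activity lamHat τ := by
  unfold activity
  rw [supp_add h, Finset.prod_union h]
  congr 1
  · refine Finset.prod_congr rfl fun i hi => ?_
    rw [add_apply_of_mem_left h hi]
  · refine Finset.prod_congr rfl fun i hi => ?_
    rw [add_comm σ τ, add_apply_of_mem_left h.symm hi]

lemma pairing_add (ψ : Site L → ℝ) (σ τ : Site L → ℤ) :
    pairing ψ (σ + τ) = pairing ψ σ + pairing ψ τ := by
  simp [pairing, mul_add, Finset.sum_add_distrib]

lemma pairing_neg (ψ : Site L → ℝ) (σ : Site L → ℤ) : pairing ψ (-σ) = -pairing ψ σ := by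
  simp [pairing]

/-- The factor of an item. -/
noncomputable def Item.factor (lamHat : Site L → ℕ → ℝ) (ψ : Site L → ℝ) (x : Item L) : ℝ :=
  1 + 3 ^ x.exp * activity lamHat x.dens * Real.cos (pairing ψ x.dens)

/-- The product of the factors of the items of a list. -/
noncomputable def listProd (lamHat : Site L → ℕ → ℝ) (l : List (Item L)) (ψ : Site L → ℝ) : ℝ :=
  (l.map (Item.factor lamHat ψ)).prod

lemma listProd_perm (lamHat : Site L → ℕ → ℝ) {l l' : List (Item L)} (h : l.Perm l') :
    listProd lamHat l = listProd lamHat l' := by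
  funext ψ
  exact (h.map _).prod_eq

/-- The expansion cos x cos y = (cos(x+y) + cos(x-y))/2, with the weights 1/3, 1/3, 1/6, 1/6
compensated by one factor 3 each. The sites s and t enter only the marks, which the factors ignore.
-/
lemma listProd_merge (lamHat : Site L → ℕ → ℝ) {x y : Item L} (s t : Site L) (l : List (Item L))
    (h : Disjoint (supp x.dens) (supp y.dens)) :
    listProd lamHat (x :: y :: l) =
      (1 / 3 : ℝ) • listProd lamHat (x.survive t :: l) +
      (1 / 3 : ℝ) • listProd lamHat (y.survive s :: l) +
      (1 / 6 : ℝ) • listProd lamHat (x.add y :: l) +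
      (1 / 6 : ℝ) • listProd lamHat (x.add y.neg :: l) := by
  funext ψ
  have h' : Disjoint (supp x.dens) (supp (-y.dens)) := by rwa [supp_neg]
  simp only [listProd, List.map_cons, List.prod_cons, Pi.add_apply, Pi.smul_apply, smul_eq_mul,
    Item.factor, Item.survive, Item.add, Item.neg, activity_add lamHat h, activity_add lamHat h',
    activity_neg, pairing_add, pairing_neg, Real.cos_add, Real.cos_neg, Real.sin_neg, pow_add,
    pow_one]
  ring

lemma four_mem_of_convex {E : Type*} [AddCommGroup E] [Module ℝ E] {H : Set E} (hH : Convex ℝ H)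
    {a b c d : E} (ha : a ∈ H) (hb : b ∈ H) (hc : c ∈ H) (hd : d ∈ H) :
    (1 / 3 : ℝ) • a + (1 / 3 : ℝ) • b + (1 / 6 : ℝ) • c + (1 / 6 : ℝ) • d ∈ H := by
  have h1 := hH hc hd (a := 1 / 2) (b := 1 / 2) (by norm_num) (by norm_num) (by norm_num)
  have h2 := hH hb h1 (a := 1 / 2) (b := 1 / 2) (by norm_num) (by norm_num) (by norm_num)
  have h3 := hH ha h2 (a := 1 / 3) (b := 2 / 3) (by norm_num) (by norm_num) (by norm_num)
  convert h3 using 1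
  module

/-- One scale of the merging procedure. -/
lemma listProd_mem_of_listInv {lamHat : Site L → ℕ → ℝ} {H : Set ((Site L → ℝ) → ℝ)}
    (hH : Convex ℝ H) (hL : 1 < L) (hα : 1 ≤ α) (k : ℕ)
    (hnext : ∀ l : List (Item L), ListInv bc α k (2 ^ (k + 1)) l → listProd lamHat l ∈ H) (n : ℕ) :
    ∀ (m : ℕ) (l : List (Item L)), 2 ^ k ≤ m → m ≤ 2 ^ (k + 1) →
      2 ^ (k + 1) - m + l.length ≤ n → ListInv bc α k m l → listProd lamHat l ∈ H := by
  induction n with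
  | zero =>
    intro m l hk hm hn h
    have : m = 2 ^ (k + 1) := by omega
    exact hnext l (this ▸ h)
  | succ n ih =>
    intro m l hk hm hn h
    -- Each round either raises m or shortens the list by one, so the sum of the remaining distances
    -- and the length decreases.
    rcases hm.eq_or_lt with rfl | hm
    · exact hnext l h
    rcases h.succ_or_linked with h | ⟨x, y, l', hp, hlink⟩
    · exact ih (m + 1) l (by omega) hm (by omega) h
    have h := h.perm hp
    have hx := h.item x List.mem_cons_self
    have hy := h.tail.item y List.mem_cons_self
    have hpx := (List.pairwise_cons.1 h.pair).1
    have hpy := (List.pairwise_cons.1 h.tail.pair).1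
    have hxy := hpx y List.mem_cons_self
    have hpx' : ∀ w ∈ l', PairInv bc α k m x w := fun w hw => hpx w (List.mem_cons_of_mem _ hw)
    have hlen := hp.length_eq
    simp only [List.length_cons] at hlen
    have hmem : ∀ z : Item L, ItemInv bc α k m z → (∀ w ∈ l', PairInv bc α k m z w) →
        listProd lamHat (z :: l') ∈ H := fun z hz hzw =>
      ih m (z :: l') hk hm.le (by simp only [List.length_cons]; omega) (.cons hz hzw h.tail.tail)
    obtain ⟨i, hi, t, ht, hd⟩ := hlink.exists_dist
    rw [listProd_perm lamHat hp, listProd_merge lamHat i t l' hlink.disjoint]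
    refine four_mem_of_convex hH (hmem _ ?_ ?_) (hmem _ ?_ ?_) (hmem _ ?_ ?_) (hmem _ ?_ ?_)
    · exact hx.survive hxy hlink hk hm hi ht hd
    · exact fun w hw => (hpx' w hw).survive (hpy w hw) hlink hk ht
    · exact hy.survive hxy.symm hlink.symm hk hm ht hi (by rwa [SimpleGraph.dist_comm])
    · exact fun w hw => (hpy w hw).survive (hpx' w hw) hlink.symm hk hi
    · exact hx.add hy hxy hlink hL hα hk
    · exact fun w hw => (hpx' w hw).add (hpy w hw) hlink hk
    · exact hx.add hy.neg hxy.neg_right hlink.neg_right hL hα hk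
    · exact fun w hw => (hpx' w hw).add (hpy w hw).neg_left hlink.neg_right hk

lemma listProd_remark (lamHat : Site L → ℕ → ℝ) (l : List (Item L)) :
    listProd lamHat (l.map Item.remark) = listProd lamHat l := by
  funext ψ
  simp only [listProd, List.map_map]
  rfl

/-- All scales of the merging procedure. -/
lemma listProd_mem_of_scaleInv {lamHat : Site L → ℕ → ℝ} {H : Set ((Site L → ℝ) → ℝ)}
    (hH : Convex ℝ H) (hL : 1 < L) (hα : 1 ≤ α)
    (hlast : ∀ l : List (Item L), ScaleInv bc α (2 * L) l → listProd lamHat l ∈ H) (n : ℕ) :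
    ∀ (k : ℕ) (l : List (Item L)), k + n = 2 * L → ScaleInv bc α k l → listProd lamHat l ∈ H := by
  induction n with
  | zero =>
    intro k l hk h
    exact hlast l (by simpa [← hk] using h)
  | succ n ih =>
    intro k l hk h
    rw [← listProd_remark]
    exact listProd_mem_of_listInv hH hL hα k
      (fun l' h' => ih (k + 1) l' (by omega) (h'.scaleInv hL hα (by omega))) _ (2 ^ k) _ le_rfl
      (Nat.pow_le_pow_right two_pos k.le_succ) le_rfl h.listInv

/-! ### Final ensembles and their mixtures -/

/-- An ensemble of the required kind. -/
structure GoodEnsemble (bc : BC) (α : ℝ) (E : Finset (Site L → ℤ)) : Prop where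
  isEnsemble : IsEnsemble E
  not_both_charged : ∀ ρ₁ ∈ E, ∀ ρ₂ ∈ E, ¬ Neutral ρ₁ → ¬ Neutral ρ₂ → ρ₁ = ρ₂
  le_distance : ∀ ρ₁ ∈ E, ∀ ρ₂ ∈ E, ρ₁ ≠ ρ₂ →
    M * (min (diam bc ρ₁ : ℝ) (diam bc ρ₂ : ℝ)) ^ α ≤ (distance bc ρ₁ ρ₂ : ℝ)
  le_distance_charged : ∀ ρc ∈ E, ¬ Neutral ρc → ∀ ρ ∈ E, ρ ≠ ρc →
    M * (diam bc ρ : ℝ) ^ α ≤ (distance bc ρ ρc : ℝ)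
  irred : ∀ ρ ∈ E, Neutral ρ → ∀ ρ₁ ρ₂ : Site L → ℤ, ρ₁ ≠ 0 → ρ₂ ≠ 0 →
    Disjoint (supp ρ₁) (supp ρ₂) → ρ = ρ₁ + ρ₂ →
    2 * M * (min (diam bc ρ₁ : ℝ) (diam bc ρ₂ : ℝ)) ^ α ≤ (distance bc ρ₁ ρ₂ : ℝ) →
    ¬ Neutral ρ₁ ∧ ¬ Neutral ρ₂

/-- Two densities with disjoint supports which do not interact. -/
def Separated (bc : BC) (α : ℝ) (σ τ : Site L → ℤ) : Prop :=
  Disjoint (supp σ) (supp τ) ∧ ∀ i ∈ supp σ, ∀ j ∈ supp τ,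
    Reaches bc α σ ((domain bc L).dist i j) → ¬ Reaches bc α τ ((domain bc L).dist i j)

lemma Separated.symm {σ τ : Site L → ℤ} (h : Separated bc α σ τ) : Separated bc α τ σ := by
  refine ⟨h.1.symm, fun i hi j hj h1 h2 => ?_⟩
  rw [SimpleGraph.dist_comm] at h1 h2
  exact h.2 j hj i hi h2 h1

lemma exists_distance_eq {σ τ : Site L → ℤ} (hσ : σ ≠ 0) (hτ : τ ≠ 0) :
    ∃ i ∈ supp σ, ∃ j ∈ supp τ, distance bc σ τ = (domain bc L).dist i j := by
  obtain ⟨i, hi⟩ := supp_nonempty hσ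
  obtain ⟨j, hj⟩ := supp_nonempty hτ
  exact Nat.sInf_mem (s := {n | ∃ i ∈ supp σ, ∃ j ∈ supp τ, n = (domain bc L).dist i j})
    ⟨_, i, hi, j, hj, rfl⟩

lemma distance_le {σ τ : Site L → ℤ} {i j : Site L} (hi : i ∈ supp σ) (hj : j ∈ supp τ) :
    distance bc σ τ ≤ (domain bc L).dist i j :=
  Nat.sInf_le ⟨i, hi, j, hj, rfl⟩

lemma distance_comm (σ τ : Site L → ℤ) : distance bc σ τ = distance bc τ σ := by
  unfold distance
  congr 1
  ext n
  constructor <;> rintro ⟨i, hi, j, hj, h⟩ <;>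
    exact ⟨j, hj, i, hi, by rwa [SimpleGraph.dist_comm]⟩

lemma Separated.not_reaches {σ τ : Site L → ℤ} (h : Separated bc α σ τ) (hσ : σ ≠ 0)
    (hτ : τ ≠ 0) : ¬ Reaches bc α σ (distance bc σ τ) ∨ ¬ Reaches bc α τ (distance bc σ τ) := by
  obtain ⟨i, hi, j, hj, hd⟩ := exists_distance_eq (bc := bc) hσ hτ
  rw [hd]
  by_contra hc
  push Not at hc
  exact h.2 i hi j hj hc.1 hc.2

lemma not_reaches_iff {ρ : Site L → ℤ} {r : ℕ} :
    ¬ Reaches bc α ρ r ↔ Neutral ρ ∧ M * (diam bc ρ : ℝ) ^ α ≤ r := by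
  simp [Reaches]

lemma NeutralIrreducible.distance_lt {σ τ : Site L → ℤ} (h : NeutralIrreducible bc α (σ + τ))
    (hd : Disjoint (supp σ) (supp τ)) (hσ : σ ≠ 0) (hτ : τ ≠ 0) (hn : Neutral σ) :
    (distance bc σ τ : ℝ) < M * (diam bc σ : ℝ) ^ α := by
  have hs := supp_add_sdiff_left hd
  obtain ⟨i, hi, j, hj, hlt⟩ := h (supp σ) (by simp [supp_add hd]) (supp_nonempty hσ)
    (by rw [hs]; exact supp_nonempty hτ) (by
      rw [Neutral, charge_eq_sum_supp] at hn
      rw [← hn]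
      exact Finset.sum_congr rfl fun i hi => add_apply_of_mem_left hd hi)
  rw [hs] at hj
  exact lt_of_le_of_lt (by exact_mod_cast distance_le hi hj) hlt

lemma charge_add (σ τ : Site L → ℤ) : charge (σ + τ) = charge σ + charge τ := by
  simp [charge, Finset.sum_add_distrib]

/-- In each pair one density fails to reach the other, hence is neutral with M d^α at most the
distance; if the other is charged, it is this one whose range is bounded. -/
lemma goodEnsemble_of_separated {E : Finset (Site L → ℤ)} (hα : 0 ≤ α)
    (h0 : ∀ ρ ∈ E, ρ ≠ 0) (hirr : ∀ ρ ∈ E, NeutralIrreducible bc α ρ)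
    (hsep : ∀ ρ₁ ∈ E, ∀ ρ₂ ∈ E, ρ₁ ≠ ρ₂ → Separated bc α ρ₁ ρ₂) : GoodEnsemble bc α E where
  isEnsemble := ⟨h0, fun ρ₁ h₁ ρ₂ h₂ hne => (hsep ρ₁ h₁ ρ₂ h₂ hne).1⟩
  not_both_charged ρ₁ h₁ ρ₂ h₂ hn₁ hn₂ := by
    by_contra hne
    rcases (hsep ρ₁ h₁ ρ₂ h₂ hne).not_reaches (h0 _ h₁) (h0 _ h₂) with h | h
    · exact hn₁ (not_reaches_iff.1 h).1
    · exact hn₂ (not_reaches_iff.1 h).1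
  le_distance ρ₁ h₁ ρ₂ h₂ hne := by
    rcases (hsep ρ₁ h₁ ρ₂ h₂ hne).not_reaches (h0 _ h₁) (h0 _ h₂) with h | h
    · refine le_trans ?_ (not_reaches_iff.1 h).2
      exact mul_le_mul_of_nonneg_left
        (Real.rpow_le_rpow (by positivity) (min_le_left _ _) hα) M_pos.le
    · refine le_trans ?_ (not_reaches_iff.1 h).2
      exact mul_le_mul_of_nonneg_left
        (Real.rpow_le_rpow (by positivity) (min_le_right _ _) hα) M_pos.le
  le_distance_charged ρc hc hn ρ h hne := by
    rcases (hsep ρ h ρc hc hne).not_reaches (h0 _ h) (h0 _ hc) with h | h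
    · exact (not_reaches_iff.1 h).2
    · exact absurd (not_reaches_iff.1 h).1 hn
  irred := by
    rintro ρ hρ hn ρ₁ ρ₂ h₁ h₂ hd rfl hle
    rw [Neutral, charge_add] at hn
    have hiff : Neutral ρ₁ ↔ Neutral ρ₂ := by
      unfold Neutral
      omega
    rw [← hiff, and_self]
    intro hn₁
    have hirr₁ := hirr _ hρ
    have hirr₂ := hirr₁
    rw [add_comm] at hirr₂
    -- Both parts being neutral, the distance is less than M d^α for each of them, hence for the
    -- smaller diameter too; this contradicts even the bound with M in place of 2M.
    have k₁ := hirr₁.distance_lt hd h₁ h₂ hn₁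
    have k₂ := hirr₂.distance_lt hd.symm h₂ h₁ (hiff.1 hn₁)
    rw [distance_comm] at k₂
    have hM := M_pos
    have hpos : (0 : ℝ) ≤ M * (min (diam bc ρ₁ : ℝ) (diam bc ρ₂ : ℝ)) ^ α := by positivity
    rcases min_choice (diam bc ρ₁ : ℝ) (diam bc ρ₂ : ℝ) with hmin | hmin <;>
      rw [hmin] at hle hpos <;> linarith

/-- The product `∏_{ρ ∈ E} [1 + K(ρ) cos⟨ψ, ρ⟩]`. -/
noncomputable def ensembleProd (K : (Site L → ℤ) → ℝ) (E : Finset (Site L → ℤ))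
    (ψ : Site L → ℝ) : ℝ :=
  ∏ ρ ∈ E, (1 + K ρ * Real.cos (pairing ψ ρ))

/-- The convex combinations of the products over good ensembles. -/
def mixtures (bc : BC) (α : ℝ) (K : (Site L → ℤ) → ℝ) : Set ((Site L → ℝ) → ℝ) :=
  {f | ∃ w : Finset (Site L → ℤ) →₀ ℝ, (∀ E, 0 ≤ w E) ∧ (∀ E ∈ w.support, GoodEnsemble bc α E) ∧
    Finsupp.linearCombination ℝ (fun _ => (1 : ℝ)) w = 1 ∧
    f = Finsupp.linearCombination ℝ (ensembleProd K) w}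

lemma convex_mixtures (K : (Site L → ℤ) → ℝ) : Convex ℝ (mixtures bc α K) := by
  classical
  rintro f ⟨w, h0, hg, h1, rfl⟩ f' ⟨w', h0', hg', h1', rfl⟩ a b ha hb hab
  refine ⟨a • w + b • w', fun E => ?_, fun E hE => ?_, ?_, ?_⟩
  · have := h0 E
    have := h0' E
    simp only [Finsupp.add_apply, Finsupp.smul_apply, smul_eq_mul]
    positivity
  · rcases Finset.mem_union.1 (Finsupp.support_add hE) with h | h
    · exact hg E (Finsupp.support_smul h)
    · exact hg' E (Finsupp.support_smul h)
  · simp [map_add, map_smul, h1, h1', hab]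
  · simp [map_add, map_smul]

lemma ensembleProd_mem_mixtures {K : (Site L → ℤ) → ℝ} {E : Finset (Site L → ℤ)}
    (hE : GoodEnsemble bc α E) : ensembleProd K E ∈ mixtures bc α K := by
  classical
  refine ⟨Finsupp.single E 1, fun E' => ?_, fun E' hE' => ?_, by simp, by simp⟩
  · rw [Finsupp.single_apply]
    split_ifs <;> simp
  · have := Finset.mem_singleton.1 (Finsupp.support_single_subset hE')
    rwa [this]

/-- The coefficient of a density in the final ensembles. -/
noncomputable def coefficient (bc : BC) (α : ℝ) (lamHat : Site L → ℕ → ℝ) (ρ : Site L → ℤ) : ℝ :=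
  3 ^ (100 * maxExponent bc α ρ) * activity lamHat ρ

/-- Raising the exponents to their maximal values. -/
lemma listProd_mul_mem_mixtures (lamHat : Site L → ℕ → ℝ) (hα : 0 ≤ α) (l : List (Item L)) :
    ∀ l₁ : List (Site L → ℤ), (∀ x ∈ l, x.exp ≤ 100 * maxExponent bc α x.dens) →
      (∀ ρ ∈ l₁ ++ l.map Item.dens, ρ ≠ 0 ∧ NeutralIrreducible bc α ρ) →
      (l₁ ++ l.map Item.dens).Pairwise (Separated bc α) →
      (fun ψ => (l₁.map fun ρ => 1 + coefficient bc α lamHat ρ * Real.cos (pairing ψ ρ)).prod *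
        listProd lamHat l ψ) ∈ mixtures bc α (coefficient bc α lamHat) := by
  classical
  induction l with
  | nil =>
    intro l₁ _ hρ hp
    simp only [List.map_nil, List.append_nil] at hρ hp
    have hnd : l₁.Nodup := by
      refine hp.imp_of_mem ?_
      rintro σ τ hσ - hsep rfl
      obtain ⟨i, hi⟩ := supp_nonempty (hρ σ hσ).1
      exact Finset.disjoint_left.1 hsep.1 hi hi
    have hgood : GoodEnsemble bc α l₁.toFinset := by
      refine goodEnsemble_of_separated hα (fun ρ h => (hρ ρ (List.mem_toFinset.1 h)).1)
        (fun ρ h => (hρ ρ (List.mem_toFinset.1 h)).2) fun ρ₁ h₁ ρ₂ h₂ hne => ?_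
      have : Std.Symm (Separated (L := L) bc α) := ⟨fun _ _ h => h.symm⟩
      exact hp.forall (List.mem_toFinset.1 h₁) (List.mem_toFinset.1 h₂) hne
    convert ensembleProd_mem_mixtures (K := coefficient bc α lamHat) hgood using 1
    funext ψ
    simp [listProd, ensembleProd, List.prod_toFinset _ hnd]
  | cons x l ih =>
    intro l₁ hexp hρ hp
    have hperm : (l₁ ++ (x :: l).map Item.dens).Perm ((x.dens :: l₁) ++ l.map Item.dens) :=
      List.perm_middle
    have hsub : (l₁ ++ l.map Item.dens).Sublist (l₁ ++ (x :: l).map Item.dens) :=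
      (List.sublist_cons_self _ _).append_left _
    have hexp' : ∀ y ∈ l, y.exp ≤ 100 * maxExponent bc α y.dens :=
      fun y hy => hexp y (List.mem_cons_of_mem _ hy)
    have h1 := ih (x.dens :: l₁) hexp' (fun ρ h => hρ ρ (hperm.mem_iff.2 h))
      ((hperm.pairwise_iff fun h => Separated.symm h).1 hp)
    have h2 := ih l₁ hexp' (fun ρ h => hρ ρ (hsub.subset h)) (hp.sublist hsub)
    have hle := hexp x List.mem_cons_self
    -- With d factors 3 missing, 1 + 3^e u = 3^{-d} (1 + 3^{e+d} u) + (1 - 3^{-d}) · 1: `h1` keeps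
    -- the density at full exponent, `h2` drops it, and dropping a density preserves separation.
    obtain ⟨d, hd⟩ := Nat.exists_eq_add_of_le hle
    have h3 : ((1 : ℝ) / 3) ^ d ≤ 1 := pow_le_one₀ (by norm_num) (by norm_num)
    have h4 : (0 : ℝ) ≤ (1 / 3) ^ d := by positivity
    convert convex_mixtures _ h1 h2 h4 (sub_nonneg.2 h3) (by ring) using 1
    funext ψ
    simp only [listProd, List.map_cons, List.prod_cons, Item.factor, coefficient, hd, pow_add,
      Pi.add_apply, Pi.smul_apply, smul_eq_mul]
    have h5 : ((1 : ℝ) / 3) ^ d * 3 ^ d = 1 := by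
      rw [← mul_pow]
      norm_num
    linear_combination (-(3 : ℝ) ^ x.exp * activity lamHat x.dens *
      Real.cos (pairing ψ x.dens) *
      (l₁.map fun ρ => 1 + 3 ^ (100 * maxExponent bc α ρ) * activity lamHat ρ *
        Real.cos (pairing ψ ρ)).prod * (l.map (Item.factor lamHat ψ)).prod) * h5

lemma ScaleInv.mem_mixtures (lamHat : Site L → ℕ → ℝ) (hL : 1 < L) (hα : 0 ≤ α)
    {l : List (Item L)} (h : ScaleInv bc α (2 * L) l) :
    listProd lamHat l ∈ mixtures bc α (coefficient bc α lamHat) := by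
  have := listProd_mul_mem_mixtures (bc := bc) lamHat hα l [] h.exp_le_max ?_ ?_
  · simpa using this
  · intro ρ hρ
    simp only [List.nil_append, List.mem_map] at hρ
    obtain ⟨x, hx, rfl⟩ := hρ
    exact ⟨h.ne_zero x hx, h.irred x hx⟩
  · rw [List.nil_append, List.pairwise_map]
    refine h.pair.imp fun {x y} hxy => ⟨hxy.1, fun i hi j hj h1 h2 => ?_⟩
    -- An interacting pair would be at distance at least 2^(2L), but all distances are below 2L.
    have k1 := hxy.2 i hi j hj h1 h2
    have k2 := dist_lt_two_mul bc hL i j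
    have k3 := Nat.lt_two_pow_self (n := 2 * L)
    omega

end Mixtures

/-! ### The initial expansion into single-site charges -/

section Start

variable {bc : BC} {α : ℝ} {L : ℕ}

/-- Comparison with a geometric series: e^{-(n+1)²} ≤ e^{-1} e^{-2n} ≤ (3/8) 4^{-n}, whose sum is
1/2. This makes the weight left for charge 0 nonnegative. -/
lemma sum_exp_neg_sq_le (N : ℕ) :
    ∑ q ∈ Finset.Icc 1 N, Real.exp (-(q : ℝ) ^ 2) ≤ 1 / 2 - 1 / 2 * (1 / 4) ^ N := by
  induction N with
  | zero => simp
  | succ N ih =>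
    rw [Finset.sum_Icc_succ_top (by omega)]
    have he := Real.exp_one_gt_d9
    have h1 : Real.exp (-1) ≤ 3 / 8 := by
      rw [Real.exp_neg, inv_le_comm₀ (Real.exp_pos _) (by norm_num)]
      linarith
    have h2 : Real.exp (-2) ≤ 1 / 4 := by
      have : Real.exp (-2) = Real.exp (-1) * Real.exp (-1) := by
        rw [← Real.exp_add]
        norm_num
      have := Real.exp_pos (-1)
      nlinarith
    have h3 : Real.exp (-((N + 1 : ℕ) : ℝ) ^ 2) ≤ 3 / 8 * (1 / 4) ^ N := by
      calc Real.exp (-((N + 1 : ℕ) : ℝ) ^ 2) ≤ Real.exp (-1 + N * (-2)) := by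
            apply Real.exp_le_exp.2
            push_cast
            nlinarith [sq_nonneg (N : ℝ)]
        _ = Real.exp (-1) * Real.exp (-2) ^ N := by
            rw [Real.exp_add, Real.exp_nat_mul]
        _ ≤ 3 / 8 * (1 / 4) ^ N := by gcongr
    rw [pow_succ (1 / 4 : ℝ)]
    linarith

/-- The probability of the charge `q` in the initial expansion. -/
noncomputable def chargeProb (N q : ℕ) : ℝ :=
  if q = 0 then 1 - ∑ q ∈ Finset.Icc 1 N, 2 * Real.exp (-(q : ℝ) ^ 2)
  else 2 * Real.exp (-(q : ℝ) ^ 2)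

/-- The factor of the charge `q` in the initial expansion. -/
noncomputable def chargeFactor (c : ℕ → ℝ) (φ : ℝ) (q : ℕ) : ℝ :=
  if q = 0 then 1 else 1 + Real.exp ((q : ℝ) ^ 2) * c q * Real.cos (q * φ)

lemma chargeProb_nonneg (N q : ℕ) : 0 ≤ chargeProb N q := by
  unfold chargeProb
  split_ifs
  · rw [← Finset.mul_sum]
    have h1 := sum_exp_neg_sq_le N
    have h2 : (0 : ℝ) ≤ (1 / 4) ^ N := by positivity
    linarith
  · positivity

lemma zero_notMem_Icc_one (N : ℕ) : 0 ∉ Finset.Icc 1 N := by simp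

lemma sum_chargeProb (N : ℕ) : ∑ q ∈ insert 0 (Finset.Icc 1 N), chargeProb N q = 1 := by
  rw [Finset.sum_insert (zero_notMem_Icc_one N)]
  have : ∑ q ∈ Finset.Icc 1 N, chargeProb N q =
      ∑ q ∈ Finset.Icc 1 N, 2 * Real.exp (-(q : ℝ) ^ 2) := by
    refine Finset.sum_congr rfl fun q hq => ?_
    rw [chargeProb, if_neg]
    have := Finset.mem_Icc.1 hq
    omega
  rw [this, chargeProb, if_pos rfl]
  ring

lemma sum_chargeProb_mul (c : ℕ → ℝ) (N : ℕ) (φ : ℝ) :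
    1 + 2 * ∑ q ∈ Finset.Icc 1 N, c q * Real.cos (q * φ) =
      ∑ q ∈ insert 0 (Finset.Icc 1 N), chargeProb N q * chargeFactor c φ q := by
  have h : ∑ q ∈ insert 0 (Finset.Icc 1 N), chargeProb N q * chargeFactor c φ q =
      ∑ q ∈ insert 0 (Finset.Icc 1 N), chargeProb N q +
        ∑ q ∈ insert 0 (Finset.Icc 1 N), chargeProb N q * (chargeFactor c φ q - 1) := by
    rw [← Finset.sum_add_distrib]
    exact Finset.sum_congr rfl fun q _ => by ring
  rw [h, sum_chargeProb, Finset.sum_insert (zero_notMem_Icc_one N), Finset.mul_sum]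
  simp only [chargeFactor, if_true, sub_self, mul_zero, zero_add]
  congr 1
  refine Finset.sum_congr rfl fun q hq => ?_
  have hq : q ≠ 0 := by
    have := Finset.mem_Icc.1 hq
    omega
  rw [chargeProb, if_neg hq, if_neg hq]
  have : Real.exp (-(q : ℝ) ^ 2) * Real.exp ((q : ℝ) ^ 2) = 1 := by
    rw [← Real.exp_add]
    simp
  linear_combination (-2 * c q * Real.cos (q * φ)) * this

/-- The item of a charge at a single site. -/
def Item.single (η : Site L → ℕ) (j : Site L) : Item L := ⟨Pi.single j (η j : ℤ), 0, ∅⟩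

lemma supp_single {j : Site L} {a : ℤ} (ha : a ≠ 0) :
    supp (Pi.single j a : Site L → ℤ) = {j} := by
  ext i
  rw [mem_supp, Finset.mem_singleton]
  by_cases h : i = j
  · subst h
    simp [ha]
  · simp [h]

lemma Item.factor_single (lamHat : Site L → ℕ → ℝ) (ψ : Site L → ℝ) (η : Site L → ℕ)
    {j : Site L} (h : η j ≠ 0) :
    (Item.single η j).factor lamHat ψ = chargeFactor (lamHat j) (ψ j) (η j) := by
  have hp : pairing ψ (Pi.single j (η j : ℤ)) = η j * ψ j := by
    unfold pairing
    rw [Finset.sum_eq_single j]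
    · simp [mul_comm]
    · intro i _ hi
      simp [hi]
    · simp
  have ha : activity lamHat (Pi.single j (η j : ℤ)) =
      Real.exp ((η j : ℝ) ^ 2) * lamHat j (η j) := by
    unfold activity
    rw [supp_single (by exact_mod_cast h)]
    simp
  simp [Item.factor, Item.single, chargeFactor, h, hp, ha]

/-- The items of a configuration of charges. -/
noncomputable def initialItems (η : Site L → ℕ) : List (Item L) :=
  (Finset.univ.filter fun j => η j ≠ 0).toList.map (Item.single η)

lemma listProd_initialItems (lamHat : Site L → ℕ → ℝ) (η : Site L → ℕ) (ψ : Site L → ℝ) :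
    listProd lamHat (initialItems η) ψ = ∏ j, chargeFactor (lamHat j) (ψ j) (η j) := by
  have h : listProd lamHat (initialItems η) ψ =
      ∏ j ∈ Finset.univ.filter (fun j => η j ≠ 0), (Item.single η j).factor lamHat ψ := by
    rw [listProd, initialItems, List.map_map]
    exact Finset.prod_map_toList _ _
  rw [h, Finset.prod_filter]
  refine Finset.prod_congr rfl fun j _ => ?_
  split_ifs with hj
  · exact Item.factor_single lamHat ψ η hj
  · rw [not_not] at hj
    simp [chargeFactor, hj]

/-- One-point supports cannot be split, and at scale 0 separation only asks distinct sites to be at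
distance at least 1. -/
lemma scaleInv_initialItems (bc : BC) (α : ℝ) (hL : 1 < L) (η : Site L → ℕ) :
    ScaleInv bc α 0 (initialItems η) := by
  have hmem : ∀ x ∈ initialItems η, ∃ j, η j ≠ 0 ∧ x = Item.single η j := by
    intro x hx
    simp only [initialItems, List.mem_map, Finset.mem_toList, Finset.mem_filter,
      Finset.mem_univ, true_and] at hx
    obtain ⟨j, hj, rfl⟩ := hx
    exact ⟨j, hj, rfl⟩
  have hsupp : ∀ j, η j ≠ 0 → supp (Item.single η j).dens = {j} :=
    fun j hj => supp_single (by exact_mod_cast hj)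
  have hsplit : ∀ x ∈ initialItems η, ∀ S ⊆ supp x.dens, S.Nonempty →
      ¬ (supp x.dens \ S).Nonempty := by
    intro x hx S hS h1 h2
    obtain ⟨j, hj, rfl⟩ := hmem x hx
    rw [hsupp j hj] at hS h2
    rcases Finset.subset_singleton_iff.1 hS with rfl | rfl
    · simp at h1
    · simp at h2
  refine ⟨?_, ?_, ?_, ?_, ?_, ?_⟩
  · intro x hx
    obtain ⟨j, hj, rfl⟩ := hmem x hx
    intro h0
    have := congrFun h0 j
    simp [Item.single, hj] at this
  · exact fun x hx S hS h1 h2 => absurd h2 (hsplit x hx S hS h1)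
  · exact fun x hx S hS h1 h2 => absurd h2 (hsplit x hx S hS h1)
  · intro x hx
    obtain ⟨j, -, rfl⟩ := hmem x hx
    exact Nat.zero_le _
  · intro x hx
    obtain ⟨j, -, rfl⟩ := hmem x hx
    exact Nat.zero_le _
  · rw [initialItems, List.pairwise_map]
    refine List.Pairwise.imp_of_mem ?_ (Finset.nodup_toList _)
    intro i j hi hj hij
    simp only [Finset.mem_toList, Finset.mem_filter, Finset.mem_univ, true_and] at hi hj
    rw [hsupp i hi, hsupp j hj]
    refine ⟨by simpa using hij, ?_⟩
    intro p hp q hq _ _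
    rw [hsupp i hi, Finset.mem_singleton] at hp
    rw [hsupp j hj, Finset.mem_singleton] at hq
    subst hp hq
    exact dist_pos_of_ne bc hL hij

lemma prod_trigPoly_mem_mixtures (hL : 1 < L) (hα : 1 ≤ α)
    {lam : Site L → ℝ → ℝ} {lamHat : Site L → ℕ → ℝ}
    (hlam : ∀ j, IsTrigPoly (lam j) (lamHat j)) :
    (fun ψ : Site L → ℝ => ∏ j, lam j (ψ j)) ∈ mixtures bc α (coefficient bc α lamHat) := by
  classical
  choose N _ _ hN using hlam
  have heq : (fun ψ : Site L → ℝ => ∏ j, lam j (ψ j)) =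
      ∑ η ∈ Fintype.piFinset fun j => insert 0 (Finset.Icc 1 (N j)),
        (∏ j, chargeProb (N j) (η j)) • listProd lamHat (initialItems η) := by
    funext ψ
    simp only [hN, sum_chargeProb_mul, Finset.prod_univ_sum, Finset.sum_apply, Pi.smul_apply,
      smul_eq_mul, listProd_initialItems, Finset.prod_mul_distrib]
  rw [heq]
  refine (convex_mixtures _).sum_mem (fun η _ => Finset.prod_nonneg fun j _ =>
    chargeProb_nonneg _ _) ?_ fun η _ => ?_
  · rw [← Finset.prod_univ_sum]
    simp only [sum_chargeProb, Finset.prod_const_one]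
  · exact listProd_mem_of_scaleInv (bc := bc) (convex_mixtures _) hL hα
      (fun l hl => hl.mem_mixtures lamHat hL (by linarith)) (2 * L) 0 _ (by omega)
      (scaleInv_initialItems bc α hL η)

lemma abs_coefficient_of_neutral (lamHat : Site L → ℕ → ℝ) {ρ : Site L → ℤ} (h : Neutral ρ) :
    |coefficient bc α lamHat ρ| = Real.exp (100 * Real.log 3 * (coverSum bc α ρ : ℝ)) *
      ∏ j ∈ supp ρ, (Real.exp ((ρ j : ℝ) ^ 2) * |lamHat j (ρ j).natAbs|) := by
  rw [coefficient, maxExponent, if_pos h, abs_mul, activity, Finset.abs_prod]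
  congr 1
  · rw [abs_of_pos (by positivity), ← Real.rpow_natCast, Real.rpow_def_of_pos (by norm_num)]
    push_cast
    ring_nf
  · exact Finset.prod_congr rfl fun j _ => by rw [abs_mul, abs_of_pos (Real.exp_pos _)]

end Start

end BKT

theorem theorem2p2 :
    ∃ D₂ : ℝ, 0 < D₂ ∧
      ∀ (α : ℝ), 3 / 2 < α → α < 2 →
      ∀ (bc : BKT.BC) (L : ℕ), bc.Admissible L →
      ∀ (lam : BKT.Site L → ℝ → ℝ) (lamHat : BKT.Site L → ℕ → ℝ),
        (∀ j, BKT.IsTrigPoly (lam j) (lamHat j)) →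
      ∃ (F : Finset (Finset (BKT.Site L → ℤ))) (c : Finset (BKT.Site L → ℤ) → ℝ)
        (K : (BKT.Site L → ℤ) → ℝ),
        (∀ E ∈ F, BKT.IsEnsemble E) ∧
        (∀ E ∈ F, 0 < c E) ∧
        ∑ E ∈ F, c E = 1 ∧
        (∀ ψ : BKT.Site L → ℝ,
          ∏ j, lam j (ψ j) =
            ∑ E ∈ F, c E * ∏ ρ ∈ E, (1 + K ρ * Real.cos (BKT.pairing ψ ρ))) ∧
        ∀ E ∈ F,
          -- (a)
          (∀ ρ₁ ∈ E, ∀ ρ₂ ∈ E, ¬ BKT.Neutral ρ₁ → ¬ BKT.Neutral ρ₂ → ρ₁ = ρ₂) ∧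
          -- (b)
          (∀ ρ₁ ∈ E, ∀ ρ₂ ∈ E, ρ₁ ≠ ρ₂ →
            BKT.M * (min (BKT.diam bc ρ₁ : ℝ) (BKT.diam bc ρ₂ : ℝ)) ^ α
              ≤ (BKT.distance bc ρ₁ ρ₂ : ℝ)) ∧
          (∀ ρc ∈ E, ¬ BKT.Neutral ρc → ∀ ρ ∈ E, ρ ≠ ρc →
            BKT.M * (BKT.diam bc ρ : ℝ) ^ α ≤ (BKT.distance bc ρ ρc : ℝ)) ∧
          -- (c)
          (∀ ρ ∈ E, BKT.Neutral ρ → ∀ ρ₁ ρ₂ : BKT.Site L → ℤ, ρ₁ ≠ 0 → ρ₂ ≠ 0 →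
            Disjoint (BKT.supp ρ₁) (BKT.supp ρ₂) → ρ = ρ₁ + ρ₂ →
            2 * BKT.M * (min (BKT.diam bc ρ₁ : ℝ) (BKT.diam bc ρ₂ : ℝ)) ^ α
              ≤ (BKT.distance bc ρ₁ ρ₂ : ℝ) →
            ¬ BKT.Neutral ρ₁ ∧ ¬ BKT.Neutral ρ₂) ∧
          -- (d)
          (∀ ρ ∈ E, BKT.Neutral ρ →
            |K ρ| ≤ Real.exp (D₂ * (BKT.coverSum bc α ρ : ℝ)) *
              ∏ j ∈ BKT.supp ρ,
                (Real.exp ((ρ j : ℝ) ^ 2) * |lamHat j (ρ j).natAbs|)) := by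
  -- The constant turns 3^(100 A) into an exponential; 100 is the packing number per square.
  refine ⟨100 * Real.log 3, by have := Real.log_pos (x := 3) (by norm_num); positivity, ?_⟩
  intro α hα _ bc L hL lam lamHat hlam
  obtain ⟨w, h0, hgood, h1, heq⟩ :=
    BKT.prod_trigPoly_mem_mixtures (bc := bc) (α := α) hL.one_lt (by linarith) hlam
  refine ⟨w.support, w, BKT.coefficient bc α lamHat, fun E hE => (hgood E hE).isEnsemble,
    fun E hE => (h0 E).lt_of_ne' (Finsupp.mem_support_iff.1 hE), ?_, fun ψ => ?_, fun E hE => ?_⟩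
  · simpa [Finsupp.linearCombination_apply, Finsupp.sum] using h1
  · have := congrFun heq ψ
    simpa [Finsupp.linearCombination_apply, Finsupp.sum, BKT.ensembleProd] using this
  · have h := hgood E hE
    exact ⟨h.not_both_charged, h.le_distance, h.le_distance_charged, h.irred,
      fun ρ _ hn => (BKT.abs_coefficient_of_neutral lamHat hn).le⟩
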